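/- Let $p,q,k\ge 1$ be integers with $p$ even, and put $d=\gcd(p,q)$, $p=dp'$, $q=dq'$. Let $\mathcal F$ be a germ of holomorphic foliation of $(\mathbb C^3,0)$ which, in suitable analytic coordinates $(x,y,z)$, is defined by $$\Omega=d(z^2+x^py^q)+(x^{p'}y^{q'})^k\,h(x^{p'}y^{q'})\,dz,\qquad h\in\mathbb C\{u\},\ h(0)\neq 0 .$$ Put $n=p/2$ if $2k\ge d$ and $n=kp'$ if $2k<d$. Blow up the $y$-axis $n$ times, use the chart $(x,y,t)$ with $z=x^nt$, and let $\tilde D=\{x=0\}$ be the last exceptional component, with coordinates $(y,t)$; let $\tilde{\mathcal F}$ be the strict transform of $\mathcal F$. For a loop $\gamma$ in $\tilde D\setminus\mathrm{Sing}(\tilde{\mathcal F})$ let $h_\gamma\in\mathrm{Diff}(\mathbb C,0)$ be its holonomy, obtained by lifting $\gamma$ to the leaves of $\tilde{\mathcal F}$ along the fibration $(x,y,t)\mapsto(y,t)$, with $x$ as coordinate on the transversal. For small $\varepsilon>0$ take the base point $(y,t)=(\varepsilon,1)$. Let $\alpha$ be the loop $y=\varepsilon$, $t=e^{-2\pi i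 s}$, $0\le s\le1$ (it encircles once all singular points of $\tilde{\mathcal F}$ in the line $y=\varepsilon$ of this chart, and is positively oriented around $t=\infty$). If $q$ is odd and $2k\ge d$ (so that the singular curve is $t^2+y^q=0$), let $\beta$ be the loop which goes from $(\varepsilon,1)$ to $(\varepsilon,0)$ along the segment $y=\varepsilon$, $t\in[0,1]$, then follows $y=\varepsilon e^{-2\pi i s}$, $t=0$, $0\le s\le 1$, and returns along the same segment. Then, for all sufficiently small $\varepsilon>0$, these holonomy germs exist and: 1. If $2k\ge d$, then $h_\alpha^{p/2}=\mathrm{id}$, and $h_\alpha$ is analytically linearizable with multiplier $h_\alpha'(0)=e^{-2\pi i\frac{p-2}{p}}$. 2. If $2k\ge d$ and $q$ is odd, then moreover $h_\beta^{p'}=\mathrm{id}$, and $h_\beta$ is analytically linearizable with multiplier $h_\beta'(0)=e^{2\pi i q'/p'}$. 3. If $2k<d$, then $h_\alpha^{kp'}=\mathrm{id}$, and $h_\alpha$ is analytically linearizable with multiplier $h_\alpha'(0)=e^{2\pi i/(kp')}$. -/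

import Mathlib

open Filter Topology Set

namespace QuasiOrdinaryCusp

/-- The ambient space, with coordinates `(x, y, z)`. -/
abbrev C3 : Type := ℂ × ℂ × ℂ

/-- Differential `1`-forms of type `(1, 0)` on `C3`. -/
abbrev OneForm : Type := C3 → (C3 →L[ℂ] ℂ)

/-- The pull-back `Φ^* ω`. -/
noncomputable def pullback (Φ : C3 → C3) (ω : OneForm) : OneForm :=
  fun P => (ω (Φ P)).comp (fderiv ℂ Φ P)

/-- The model form `d(z² + x^p y^q) + u^k f(u) dz`, where `u = x^{p'} y^{q'}`,
`p' = p / gcd(p, q)`, `q' = q / gcd(p, q)`. -/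
noncomputable def modelForm (p q k : ℕ) (f : ℂ → ℂ) : OneForm := fun P =>
  fderiv ℂ (fun Q : C3 => Q.2.2 ^ 2 + Q.1 ^ p * Q.2.1 ^ q) P +
    ((P.1 ^ (p / Nat.gcd p q) * P.2.1 ^ (q / Nat.gcd p q)) ^ k *
        f (P.1 ^ (p / Nat.gcd p q) * P.2.1 ^ (q / Nat.gcd p q))) •
      fderiv ℂ (fun Q : C3 => Q.2.2) P

/-- `Φ` is an analytic change of coordinates at the origin in which the foliation germ defined
by `ω` is the foliation defined by the model form; its existence says that the foliation is
analytically equivalent to the model. -/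
structure IsModelChart (p q k : ℕ) (f : ℂ → ℂ) (ω : OneForm) (Φ : C3 → C3) : Prop where
  analyticAt_form : AnalyticAt ℂ ω 0
  analyticAt_chart : AnalyticAt ℂ Φ 0
  map_zero : Φ 0 = 0
  invertible : (fderiv ℂ Φ 0).IsInvertible
  pullback_eq : ∃ u : C3 → ℂ, AnalyticAt ℂ u 0 ∧ u 0 ≠ 0 ∧
    ∀ᶠ P in 𝓝 (0 : C3), pullback Φ ω P = u P • modelForm p q k f P

/-- The composition of `n` blow-ups of the `y`-axis in the chart `(x, y, t)` in which
`z = x ^ n * t`. The last exceptional component is `x = 0`, with coordinates `(y, t)`;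
`(x, y, t) ↦ (y, t)` retracts the chart onto it. -/
def blowDown (n : ℕ) (x : ℂ) (b : ℂ × ℂ) : C3 := (x, b.1, x ^ n * b.2)

/-- `x` is the transverse coordinate of a lift of the path `γ : [0, 1] → {x = 0}` to a leaf of
the foliation `η = 0` (seen off the exceptional divisor). One-sided derivatives are used
because `γ` is piecewise smooth. -/
structure IsLift (η : OneForm) (n : ℕ) (γ : ℝ → ℂ × ℂ) (x : ℝ → ℂ) : Prop where
  continuousOn : ContinuousOn x (Icc 0 1)
  ne_zero : ∀ s ∈ Icc (0 : ℝ) 1, x s ≠ 0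
  tangent : ∀ s ∈ Ico (0 : ℝ) 1, ∃ v : C3,
    HasDerivWithinAt (fun τ => blowDown n (x τ) (γ τ)) v (Ici s) s ∧
      η (blowDown n (x s) (γ s)) v = 0

/-- `g` represents an element of `Diff(ℂ, 0)`. -/
structure IsGermDiffeo (g : ℂ → ℂ) : Prop where
  analyticAt : AnalyticAt ℂ g 0
  map_zero : g 0 = 0
  deriv_ne_zero : deriv g 0 ≠ 0

/-- `g` is the holonomy, along the path `γ` in the exceptional component `x = 0`, of the
foliation `η = 0` lifted by `blowDown n`, the transversals being the fibres `(y, t) = const`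
with coordinate `x`: in each small tube around the component, every starting point `a ≠ 0` close
enough to `0` has a lift of `γ`, and every lift of `γ` from `a` ends at `g a`. -/
structure IsHolonomy (η : OneForm) (n : ℕ) (γ : ℝ → ℂ × ℂ) (g : ℂ → ℂ) : Prop where
  germDiffeo : IsGermDiffeo g
  lifts : ∀ᶠ r in 𝓝[>] (0 : ℝ), ∀ᶠ a in 𝓝[≠] (0 : ℂ),
    (∃ x : ℝ → ℂ, IsLift η n γ x ∧ x 0 = a ∧ ∀ s ∈ Icc (0 : ℝ) 1, ‖x s‖ < r) ∧
    ∀ x : ℝ → ℂ, IsLift η n γ x → x 0 = a → (∀ s ∈ Icc (0 : ℝ) 1, ‖x s‖ < r) → x 1 = g a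

/-- `g` is analytically conjugated to the linear germ `w ↦ c * w`. -/
def LinearizableTo (g : ℂ → ℂ) (c : ℂ) : Prop :=
  ∃ φ : ℂ → ℂ, IsGermDiffeo φ ∧ ∀ᶠ w in 𝓝 (0 : ℂ), φ (g w) = c * φ w

/-- The holonomy along `γ` exists, its `m`-th iterate is the identity germ, and it is
linearizable with multiplier `c`. -/
def HasPeriodicHolonomy (η : OneForm) (n : ℕ) (γ : ℝ → ℂ × ℂ) (m : ℕ) (c : ℂ) : Prop :=
  (∃ g : ℂ → ℂ, IsHolonomy η n γ g) ∧
    ∀ g : ℂ → ℂ, IsHolonomy η n γ g →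
      (∀ᶠ w in 𝓝 (0 : ℂ), g^[m] w = w) ∧ deriv g 0 = c ∧ LinearizableTo g c

/-- The loop `α`, based at `(y, t) = (ε, 1)`: in the line `y = ε` it runs once along `|t| = 1`,
around all singular points of that line with `|t| < 1`. It is oriented positively around
`t = ∞`, the intersection with the preceding exceptional component. -/
noncomputable def loopAlpha (ε : ℝ) (s : ℝ) : ℂ × ℂ :=
  ((ε : ℂ), Complex.exp (-(2 * Real.pi * Complex.I * s)))

/-- The loop `β`, based at `(y, t) = (ε, 1)`: go to `(ε, 0)` along a segment, turn once around
the origin in the line `t = 0`, with the orientation for which `α ^ q = β ^ 2`, and come back. -/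
noncomputable def loopBeta (ε : ℝ) (s : ℝ) : ℂ × ℂ :=
  if s ≤ 1 / 3 then ((ε : ℂ), 1 - 3 * (s : ℂ))
  else if s ≤ 2 / 3 then
    ((ε : ℂ) * Complex.exp (-(2 * Real.pi * Complex.I * (3 * (s : ℂ) - 1))), 0)
  else ((ε : ℂ), 3 * (s : ℂ) - 2)

end QuasiOrdinaryCusp

/-!
Put `u = x ^ p' * y ^ q'`. In the chart `z = x ^ n * t` the strict transform of the model form is
`(n t (2 t + E) + p x ^ (p - 2 n) y ^ q) dx + x (2 t + E) dt + q x ^ (p - 2 n + 1) y ^ (q - 1) dy`,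
where `E = u ^ k f(u) / x ^ n`, so a lift of a path in the exceptional component solves a
differential equation `x' = x H(s, x)` (`IsModelBall.tangent_iff`, `IsModelBall.liftsSolve`), and
lifts are unique. It is therefore enough to exhibit enough lifts: if for a diffeomorphism germ `φ`
and a root of unity `c` there are lifts from `φ b` to `φ (c b)` for all small `b ≠ 0`, then the
holonomy is `φ ∘ (c ·) ∘ φ⁻¹` (`UniformizingFamily.hasPeriodicHolonomy`), hence periodic and
linearizable with multiplier `c`.

These lifts come from solutions `ξ(σ, a)` of `∂ξ/∂σ = K(a ξ, σ) ξ`, `ξ(0, a) = 1`, holomorphic in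
the complex time `σ` and in the parameter `a`. They are found by Picard iteration
(`IsBoundedField.exists_solution`): the iteration contracts because the unknown enters `K` only
through `a ξ` and `a` is small.

* Loop `α`, for both values of `n`. With `σ = t ^ (-1 / n)` and `x = σ X` the leaves in the plane
  `y = ε` satisfy `dX = X K(X, σ) dσ` with `K` holomorphic up to `σ = 0`, that is `t = ∞`. Each leaf
  near the component is thus a disc `x = b σ ξ(σ, b)`, `|σ| < 2`, and `α` lifts to the arc
  `σ = exp (2 π i s / n)` of that disc. Since `K` depends on `σ` only through `x` and `σ ^ n`, up to
  the factor `dσ / σ`, rotating `σ` by `ζ = exp (2 π i / n)` is the same as rotating `b`; the lift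
  of `α` goes from `φ b` to `φ (ζ b)` with `φ b = b ξ(1, b)`
  (`IsModelBall.hasPeriodicHolonomy_loopAlpha`).
* Loop `β`. Here `p = 2 n`, and `gcd p q`, being odd, is not `2 k`, so that `E` vanishes on `x = 0`.
  On `t = 0` one has `z = 0`, and the foliation is `d (x ^ p y ^ q) = 0`: the turn around `y = 0`
  multiplies `x` by `exp (2 π i q' / p')`. The segment, travelled in both directions, conjugates
  this rotation by its holonomy (`IsModelBall.hasPeriodicHolonomy_loopBeta`).
-/

namespace QuasiOrdinaryCusp

open Metric

/-! ### Holomorphic functions and parameter integrals -/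

/-- Cauchy's estimate for the derivative, on discs of radius `r / 4`. -/
theorem lipschitzOnWith_of_bounded_holomorphic {g : ℂ → ℂ} {r C : ℝ} (hr : 0 < r) (hC : 0 ≤ C)
    (hd : DifferentiableOn ℂ g (ball 0 r)) (hb : ∀ x ∈ ball (0 : ℂ) r, ‖g x‖ ≤ C) :
    LipschitzOnWith (4 * C / r).toNNReal g (ball 0 (r / 2)) := by
  have hsub : ∀ x ∈ ball (0 : ℂ) (r / 2), closedBall x (r / 4) ⊆ ball 0 r := by
    intro x hx y hy
    rw [mem_ball_zero_iff] at hx ⊢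
    rw [mem_closedBall, dist_eq_norm] at hy
    have := norm_add_le (y - x) x
    rw [sub_add_cancel] at this
    linarith
  refine (convex_ball (0 : ℂ) (r / 2)).lipschitzOnWith_of_nnnorm_deriv_le (𝕜 := ℂ) ?_ ?_
  · intro x hx
    exact hd.differentiableAt
      (isOpen_ball.mem_nhds (hsub x hx (mem_closedBall_self (by positivity))))
  · intro x hx
    rw [← NNReal.coe_le_coe, coe_nnnorm, Real.coe_toNNReal _ (by positivity)]
    have := Complex.norm_deriv_le_of_forall_mem_sphere_norm_le (c := x) (R := r / 4) (C := C)
      (f := g) (by positivity) ?_ ?_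
    · calc _ ≤ _ := this
        _ = _ := by field_simp
    · refine DifferentiableOn.diffContOnCl ?_
      rw [closure_ball _ (by positivity)]
      exact hd.mono (hsub x hx)
    · intro z hz
      exact hb z (hsub x hx (sphere_subset_closedBall hz))

/-- Integration along the segments from `0` gives a primitive on a convex set. -/
theorem hasDerivAt_mul_integral_segment {U : Set ℂ} (hU : IsOpen U) (hc : Convex ℝ U)
    (h0 : (0 : ℂ) ∈ U) {g : ℂ → ℂ} (hg : DifferentiableOn ℂ g U) {σ : ℂ} (hσ : σ ∈ U) :
    HasDerivAt (fun σ : ℂ => σ * ∫ s in (0 : ℝ)..1, g (s * σ)) (g σ) σ := by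
  obtain ⟨G, hG⟩ := hc.exists_forall_hasDerivWithinAt hg
  have hG' : ∀ a ∈ U, HasDerivAt G (g a) a := fun a ha => (hG a ha).hasDerivAt (hU.mem_nhds ha)
  have hseg : ∀ τ ∈ U, ∀ s ∈ Icc (0 : ℝ) 1, (s : ℂ) * τ ∈ U := by
    intro τ hτ s hs
    have := hc.smul_mem_of_zero_mem h0 hτ hs
    simpa using this
  have key : ∀ τ ∈ U, τ * ∫ s in (0 : ℝ)..1, g (s * τ) = G τ - G 0 := by
    intro τ hτ
    rw [← intervalIntegral.integral_const_mul]
    have := intervalIntegral.integral_eq_sub_of_hasDerivAt (a := 0) (b := 1)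
      (f := fun s : ℝ => G (s * τ)) (f' := fun s : ℝ => τ * g (s * τ)) ?_ ?_
    · simpa using this
    · intro s hs
      rw [uIcc_of_le zero_le_one] at hs
      have h1 := hG' _ (hseg τ hτ s hs)
      have h2 : HasDerivAt (fun s : ℝ => (s : ℂ) * τ) τ s := by
        simpa using (Complex.ofRealCLM.hasDerivAt (x := s)).mul_const τ
      have := h1.comp s h2
      rwa [mul_comm] at this
    · apply ContinuousOn.intervalIntegrable
      rw [uIcc_of_le zero_le_one]
      refine continuousOn_const.mul (hg.continuousOn.comp (by fun_prop) fun s hs => hseg τ hτ s hs)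
  refine ((hG' σ hσ).sub_const (G 0)).congr_of_eventuallyEq ?_
  filter_upwards [hU.mem_nhds hσ] with τ hτ using key τ hτ

/-- A parameter integral of bounded holomorphic functions is holomorphic. No joint regularity is
needed: Cauchy's estimate dominates the derivative in the parameter. -/
theorem differentiableOn_integral_of_bounded {δ C : ℝ} {F : ℂ → ℝ → ℂ}
    (hd : ∀ s ∈ Icc (0 : ℝ) 1, DifferentiableOn ℂ (fun a => F a s) (ball 0 δ))
    (hc : ∀ a ∈ ball (0 : ℂ) δ, ContinuousOn (F a) (Icc 0 1))
    (hb : ∀ a ∈ ball (0 : ℂ) δ, ∀ s ∈ Icc (0 : ℝ) 1, ‖F a s‖ ≤ C) :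
    DifferentiableOn ℂ (fun a => ∫ s in (0 : ℝ)..1, F a s) (ball 0 δ) := by
  intro a ha
  obtain ⟨e, he, hea⟩ : ∃ e > 0, ball a e ⊆ ball 0 δ := Metric.isOpen_iff.1 isOpen_ball a ha
  have hsub : ∀ x ∈ ball a (e / 2), closedBall x (e / 4) ⊆ ball 0 δ := by
    intro x hx y hy
    apply hea
    rw [mem_ball] at hx ⊢
    rw [mem_closedBall] at hy
    linarith [dist_triangle y x a]
  have hIoc : uIoc (0 : ℝ) 1 ⊆ Icc 0 1 := by
    rw [uIoc_of_le zero_le_one]; exact Ioc_subset_Icc_self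
  have hmeas : ∀ x ∈ ball (0 : ℂ) δ, MeasureTheory.AEStronglyMeasurable (F x)
      (MeasureTheory.volume.restrict (uIoc (0 : ℝ) 1)) := fun x hx =>
    ((hc x hx).mono hIoc).aestronglyMeasurable measurableSet_uIoc
  have hda : ∀ s ∈ Icc (0 : ℝ) 1, ∀ x ∈ ball a (e / 2),
      HasDerivAt (fun a => F a s) (deriv (fun a => F a s) x) x := fun s hs x hx =>
    ((hd s hs).differentiableAt (isOpen_ball.mem_nhds
      (hsub x hx (mem_closedBall_self (by positivity))))).hasDerivAt
  have := (intervalIntegral.hasDerivAt_integral_of_dominated_loc_of_deriv_le (𝕜 := ℂ)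
    (μ := MeasureTheory.volume) (a := 0) (b := 1)
    (F := F) (F' := fun x s => deriv (fun a => F a s) x) (x₀ := a) (s := ball a (e / 2))
    (bound := fun _ => C / (e / 4)) (ball_mem_nhds a (by positivity)) ?_ ?_ ?_ ?_ ?_ ?_).2
  · exact this.differentiableAt.differentiableWithinAt
  · filter_upwards [isOpen_ball.mem_nhds ha] with x hx using hmeas x hx
  · exact ContinuousOn.intervalIntegrable (by rw [uIcc_of_le zero_le_one]; exact hc a ha)
  · -- the derivative in `a` is a pointwise limit of difference quotients at `a + e / 4 / (N + 1)`
    have hlim : Tendsto (fun N : ℕ => ((e / 4 / (N + 1) : ℝ) : ℂ)) atTop (𝓝[≠] 0) := by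
      refine tendsto_nhdsWithin_iff.2 ⟨?_, Eventually.of_forall fun N => ?_⟩
      · have := (tendsto_one_div_add_atTop_nhds_zero_nat (𝕜 := ℝ)).const_mul (e / 4)
        rw [mul_zero] at this
        have h2 := (Complex.continuous_ofReal.tendsto 0).comp this
        refine (h2.congr fun N => ?_)
        simp [div_eq_mul_inv]
      · have : e / 4 / ((N : ℝ) + 1) ≠ 0 := by positivity
        exact Complex.ofReal_ne_zero.2 this
    refine aestronglyMeasurable_of_tendsto_ae (u := atTop)
      (f := fun (N : ℕ) s => ((e / 4 / (N + 1) : ℝ) : ℂ)⁻¹ •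
        (F (a + ((e / 4 / (N + 1) : ℝ) : ℂ)) s - F a s)) (fun N => ?_) ?_
    · suffices h : a + ((e / 4 / (N + 1) : ℝ) : ℂ) ∈ ball (0 : ℂ) δ from
        ((hmeas _ h).sub (hmeas a ha)).const_smul (((e / 4 / (N + 1) : ℝ) : ℂ)⁻¹)
      refine hsub a (mem_ball_self (by positivity)) ?_
      rw [mem_closedBall, dist_eq_norm, add_sub_cancel_left, Complex.norm_real, Real.norm_eq_abs,
        abs_of_nonneg (by positivity)]
      apply div_le_self (by positivity)
      linarith [(Nat.cast_nonneg N : (0 : ℝ) ≤ N)]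
    · rw [MeasureTheory.ae_restrict_iff' measurableSet_uIoc]
      refine Eventually.of_forall fun s hs => ?_
      exact (hda s (hIoc hs) a (mem_ball_self (by positivity))).tendsto_slope_zero.comp hlim
  · refine Eventually.of_forall fun s hs x hx => ?_
    refine Complex.norm_deriv_le_of_forall_mem_sphere_norm_le (by positivity) ?_ ?_
    · refine DifferentiableOn.diffContOnCl ?_
      rw [closure_ball _ (by positivity)]
      exact (hd s (hIoc hs)).mono (hsub x hx)
    · intro z hz
      exact hb z (hsub x hx (sphere_subset_closedBall hz)) s (hIoc hs)
  · exact intervalIntegrable_const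
  · exact Eventually.of_forall fun s hs x hx => hda s (hIoc hs) x hx

/-! ### Equations with a holomorphic parameter -/

theorem norm_exp_sub_exp_le {B : ℝ} {u v : ℂ} (hu : ‖u‖ ≤ B) (hv : ‖v‖ ≤ B) :
    ‖Complex.exp u - Complex.exp v‖ ≤ Real.exp B * ‖u - v‖ := by
  refine (convex_closedBall (0 : ℂ) B).norm_image_sub_le_of_norm_deriv_le (𝕜 := ℂ)
    (fun x _ => Complex.differentiable_exp.differentiableAt) (fun x hx => ?_)
    (by simpa using hv) (by simpa using hu)
  rw [Complex.deriv_exp]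
  refine (Complex.norm_exp_le_exp_norm x).trans (Real.exp_le_exp.2 (by simpa using hx))

/-- The Picard operator of the equation `∂ξ/∂σ = K (a ξ) σ ξ`, `ξ 0 a = 1`, in logarithmic form,
so that its values never vanish. The argument `Ξ` depends on the complex time `σ` and on the
parameter `a`. -/
noncomputable def picardStep (K Ξ : ℂ → ℂ → ℂ) : ℂ → ℂ → ℂ := fun σ a =>
  Complex.exp (σ * ∫ s in (0 : ℝ)..1, K (a * Ξ (s * σ) a) (s * σ))

/-- `Ξ` is bounded by `M` and holomorphic in each variable for times in `U` and parameters of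
norm less than `δ`. -/
structure IsHolomorphicFamily (U : Set ℂ) (δ M : ℝ) (Ξ : ℂ → ℂ → ℂ) : Prop where
  time : ∀ a ∈ ball (0 : ℂ) δ, DifferentiableOn ℂ (fun σ => Ξ σ a) U
  param : ∀ σ ∈ U, DifferentiableOn ℂ (Ξ σ) (ball 0 δ)
  norm_le : ∀ σ ∈ U, ∀ a ∈ ball (0 : ℂ) δ, ‖Ξ σ a‖ ≤ M

/-- A holomorphic right-hand side `K`, bounded by `C` for `‖X‖ < r` and times in a bounded convex
neighbourhood `U` of `0`. -/
structure IsBoundedField (U : Set ℂ) (R r C : ℝ) (K : ℂ → ℂ → ℂ) : Prop where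
  isOpen : IsOpen U
  convex : Convex ℝ U
  zero_mem : (0 : ℂ) ∈ U
  norm_time_le : ∀ σ ∈ U, ‖σ‖ ≤ R
  radius_pos : 0 < r
  bound_nonneg : 0 ≤ C
  differentiableOn : DifferentiableOn ℂ (fun P : ℂ × ℂ => K P.1 P.2) (ball 0 r ×ˢ U)
  norm_le : ∀ X ∈ ball (0 : ℂ) r, ∀ σ ∈ U, ‖K X σ‖ ≤ C

section Picard

variable {U : Set ℂ} {R r C δ M : ℝ} {K Ξ Ξ' : ℂ → ℂ → ℂ}

theorem IsBoundedField.mul_mem (hK : IsBoundedField U R r C K) {σ : ℂ} (hσ : σ ∈ U) {s : ℝ}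
    (hs : s ∈ Icc (0 : ℝ) 1) : (s : ℂ) * σ ∈ U := by
  simpa using hK.convex.smul_mem_of_zero_mem hK.zero_mem hσ hs

theorem IsHolomorphicFamily.mul_mem_ball (hΞ : IsHolomorphicFamily U δ M Ξ) (hM : 0 < M)
    (hδ : δ * M ≤ r / 2) {σ a : ℂ} (hσ : σ ∈ U) (ha : a ∈ ball (0 : ℂ) δ) :
    a * Ξ σ a ∈ ball (0 : ℂ) (r / 2) := by
  rw [mem_ball_zero_iff] at ha ⊢
  rw [norm_mul]
  calc ‖a‖ * ‖Ξ σ a‖ ≤ ‖a‖ * M := by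
        gcongr; exact hΞ.norm_le σ hσ a (mem_ball_zero_iff.2 ha)
    _ < δ * M := by gcongr
    _ ≤ r / 2 := hδ

theorem IsHolomorphicFamily.mul_mem_ball_radius (hΞ : IsHolomorphicFamily U δ M Ξ) (hM : 0 < M)
    (hr : 0 < r) (hδ : δ * M ≤ r / 2) {σ a : ℂ} (hσ : σ ∈ U) (ha : a ∈ ball (0 : ℂ) δ) :
    a * Ξ σ a ∈ ball (0 : ℂ) r :=
  ball_subset_ball (by linarith) (hΞ.mul_mem_ball hM hδ hσ ha)

theorem IsBoundedField.differentiableOn_comp_time (hK : IsBoundedField U R r C K)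
    (hΞ : IsHolomorphicFamily U δ M Ξ) (hM : 0 < M) (hδ : δ * M ≤ r / 2) {a : ℂ}
    (ha : a ∈ ball (0 : ℂ) δ) : DifferentiableOn ℂ (fun σ => K (a * Ξ σ a) σ) U :=
  hK.differentiableOn.comp (((hΞ.time a ha).const_mul a).prodMk differentiableOn_id)
    fun _ hσ => ⟨hΞ.mul_mem_ball_radius hM hK.radius_pos hδ hσ ha, hσ⟩

theorem IsBoundedField.continuousOn_segment (hK : IsBoundedField U R r C K)
    (hΞ : IsHolomorphicFamily U δ M Ξ) (hM : 0 < M) (hδ : δ * M ≤ r / 2) {a σ : ℂ}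
    (ha : a ∈ ball (0 : ℂ) δ) (hσ : σ ∈ U) :
    ContinuousOn (fun s : ℝ => K (a * Ξ (s * σ) a) (s * σ)) (Icc 0 1) :=
  (hK.differentiableOn_comp_time hΞ hM hδ ha).continuousOn.comp (f := fun s : ℝ => (s : ℂ) * σ)
    (by fun_prop) fun _ hs => hK.mul_mem hσ hs

theorem IsBoundedField.norm_exponent_le (hK : IsBoundedField U R r C K)
    (hΞ : IsHolomorphicFamily U δ M Ξ) (hM : 0 < M) (hδ : δ * M ≤ r / 2) {a σ : ℂ}
    (ha : a ∈ ball (0 : ℂ) δ) (hσ : σ ∈ U) :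
    ‖σ * ∫ s in (0 : ℝ)..1, K (a * Ξ (s * σ) a) (s * σ)‖ ≤ R * C := by
  rw [norm_mul]
  refine mul_le_mul (hK.norm_time_le σ hσ) ?_ (norm_nonneg _)
    ((norm_nonneg _).trans (hK.norm_time_le σ hσ))
  have := intervalIntegral.norm_integral_le_of_norm_le_const (a := (0 : ℝ)) (b := 1) (C := C)
    (f := fun s : ℝ => K (a * Ξ (s * σ) a) (s * σ)) ?_
  · simpa using this
  · intro s hs
    rw [uIoc_of_le zero_le_one] at hs
    have hs' := hK.mul_mem hσ (Ioc_subset_Icc_self hs)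
    exact hK.norm_le _ (hΞ.mul_mem_ball_radius hM hK.radius_pos hδ hs' ha) _ hs'

theorem IsBoundedField.isHolomorphicFamily_picardStep (hK : IsBoundedField U R r C K)
    (hΞ : IsHolomorphicFamily U δ M Ξ) (hM : Real.exp (R * C) ≤ M) (hδ : δ * M ≤ r / 2) :
    IsHolomorphicFamily U δ M (picardStep K Ξ) := by
  have hM0 : 0 < M := (Real.exp_pos _).trans_le hM
  refine ⟨fun a ha => ?_, fun σ hσ => ?_, fun σ hσ a ha => ?_⟩
  · refine DifferentiableOn.cexp fun σ hσ => ?_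
    exact (hasDerivAt_mul_integral_segment hK.isOpen hK.convex hK.zero_mem
      (hK.differentiableOn_comp_time hΞ hM0 hδ ha) hσ).differentiableAt.differentiableWithinAt
  · refine DifferentiableOn.cexp (DifferentiableOn.const_mul ?_ _)
    refine differentiableOn_integral_of_bounded (C := C)
      (F := fun a s => K (a * Ξ (s * σ) a) (s * σ)) (fun s hs => ?_)
      (fun a ha => hK.continuousOn_segment hΞ hM0 hδ ha hσ) (fun a ha s hs => ?_)
    · exact hK.differentiableOn.comp ((differentiableOn_id.mul
        (hΞ.param _ (hK.mul_mem hσ hs))).prodMk (differentiableOn_const _))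
        fun a ha => ⟨hΞ.mul_mem_ball_radius hM0 hK.radius_pos hδ (hK.mul_mem hσ hs) ha,
          hK.mul_mem hσ hs⟩
    · exact hK.norm_le _ (hΞ.mul_mem_ball_radius hM0 hK.radius_pos hδ (hK.mul_mem hσ hs) ha) _
        (hK.mul_mem hσ hs)
  · refine (Complex.norm_exp_le_exp_norm _).trans ((Real.exp_le_exp.2 ?_).trans hM)
    exact hK.norm_exponent_le hΞ hM0 hδ ha hσ

/-- For small parameters the Picard operator halves distances: its Lipschitz constant is
proportional to the size of the parameter. -/
theorem IsBoundedField.norm_picardStep_sub_le (hK : IsBoundedField U R r C K)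
    (hΞ : IsHolomorphicFamily U δ M Ξ) (hΞ' : IsHolomorphicFamily U δ M Ξ')
    (hM : Real.exp (R * C) ≤ M) (hδ : δ * M ≤ r / 2) (hδ0 : 0 < δ)
    (hδ' : M * R * (4 * C / r) * δ ≤ 1 / 2)
    {e : ℝ} {a : ℂ} (ha : a ∈ ball (0 : ℂ) δ) (he : ∀ σ ∈ U, ‖Ξ σ a - Ξ' σ a‖ ≤ e)
    {σ : ℂ} (hσ : σ ∈ U) :
    ‖picardStep K Ξ σ a - picardStep K Ξ' σ a‖ ≤ e / 2 := by
  have hM0 : 0 < M := (Real.exp_pos _).trans_le hM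
  have hR : 0 ≤ R := (norm_nonneg _).trans (hK.norm_time_le σ hσ)
  have hr := hK.radius_pos
  have hC := hK.bound_nonneg
  have he0 : 0 ≤ e := (norm_nonneg _).trans (he σ hσ)
  have hint : ∀ {Ξ}, IsHolomorphicFamily U δ M Ξ → IntervalIntegrable
      (fun s : ℝ => K (a * Ξ (s * σ) a) (s * σ)) MeasureTheory.volume 0 1 := fun h =>
    ContinuousOn.intervalIntegrable
      (by rw [uIcc_of_le zero_le_one]; exact hK.continuousOn_segment h hM0 hδ ha hσ)
  calc _ ≤ Real.exp (R * C) * _ := norm_exp_sub_exp_le (hK.norm_exponent_le hΞ hM0 hδ ha hσ)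
        (hK.norm_exponent_le hΞ' hM0 hδ ha hσ)
    _ ≤ M * (R * (4 * C / r * (δ * e))) := by
        gcongr
        rw [← mul_sub, norm_mul, ← intervalIntegral.integral_sub (hint hΞ) (hint hΞ')]
        refine mul_le_mul (hK.norm_time_le σ hσ) ?_ (norm_nonneg _) hR
        have := intervalIntegral.norm_integral_le_of_norm_le_const (a := (0 : ℝ)) (b := 1)
          (C := 4 * C / r * (δ * e))
          (f := fun s : ℝ => K (a * Ξ (s * σ) a) (s * σ) - K (a * Ξ' (s * σ) a) (s * σ)) ?_
        · simpa using this
        · intro s hs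
          rw [uIoc_of_le zero_le_one] at hs
          have hs' := hK.mul_mem hσ (Ioc_subset_Icc_self hs)
          have hL := lipschitzOnWith_of_bounded_holomorphic (g := fun X => K X (s * σ)) hr hC
            (hK.differentiableOn.comp (differentiableOn_id.prodMk (differentiableOn_const _))
              fun X hX => ⟨hX, hs'⟩) fun X hX => hK.norm_le X hX _ hs'
          have := hL.norm_sub_le (hΞ.mul_mem_ball hM0 hδ hs' ha) (hΞ'.mul_mem_ball hM0 hδ hs' ha)
          rw [Real.coe_toNNReal _ (by positivity), ← mul_sub, norm_mul] at this
          refine this.trans ?_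
          gcongr
          · exact (mem_ball_zero_iff.1 ha).le
          · exact he _ hs'
    _ = M * R * (4 * C / r) * δ * e := by ring
    _ ≤ 1 / 2 * e := by gcongr
    _ = e / 2 := by ring

/-- A solution `ξ` of `∂ξ/∂σ = K (a ξ) σ ξ` with `ξ 0 a = 1`, holomorphic in the time and in the
parameter. A symmetry of `K` under a rotation `η` of the time is inherited by `ξ`. -/
theorem IsBoundedField.exists_solution (hK : IsBoundedField U R r C K) :
    ∃ δ > 0, ∃ M > 0, ∃ ξ : ℂ → ℂ → ℂ, IsHolomorphicFamily U δ M ξ ∧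
      (∀ a, ξ 0 a = 1) ∧
      (∀ σ ∈ U, ∀ a ∈ ball (0 : ℂ) δ, ξ σ a ≠ 0 ∧ a * ξ σ a ∈ ball 0 r ∧
        HasDerivAt (fun σ => ξ σ a) (K (a * ξ σ a) σ * ξ σ a) σ) ∧
      ∀ η : ℂ, ‖η‖ = 1 → (∀ σ ∈ U, η * σ ∈ U) →
        (∀ X ∈ ball (0 : ℂ) r, ∀ σ ∈ U, η * K X (η * σ) = K (η * X) σ) →
        ∀ σ ∈ U, ∀ a ∈ ball (0 : ℂ) δ, ξ (η * σ) a = ξ σ (η * a) := by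
  have hr := hK.radius_pos
  have hC := hK.bound_nonneg
  have hR : 0 ≤ R := by simpa using hK.norm_time_le 0 hK.zero_mem
  set M := Real.exp (R * C) with hMdef
  have hM0 : 0 < M := Real.exp_pos _
  have hM1 : 1 ≤ M := Real.one_le_exp (by positivity)
  obtain ⟨δ, hδ0, hδ, hδ'⟩ : ∃ δ > 0, δ * M ≤ r / 2 ∧ M * R * (4 * C / r) * δ ≤ 1 / 2 := by
    refine ⟨min (r / 2 / M) (1 / 2 / (M * R * (4 * C / r) + 1)), by positivity, ?_, ?_⟩
    · rw [← le_div_iff₀ hM0]; exact min_le_left _ _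
    · have hA : 0 ≤ M * R * (4 * C / r) := by positivity
      calc _ ≤ (M * R * (4 * C / r) + 1) * (1 / 2 / (M * R * (4 * C / r) + 1)) := by
            gcongr
            · linarith
            · exact min_le_right _ _
        _ = 1 / 2 := by field_simp
  -- the Picard iterates, starting from the constant `1`; consecutive ones are `2 * M / 2 ^ j` close
  set Ξ : ℕ → ℂ → ℂ → ℂ := fun j => (picardStep K)^[j] (fun _ _ => 1) with hΞdef
  have hsucc : ∀ j, Ξ (j + 1) = picardStep K (Ξ j) := fun j =>
    Function.iterate_succ_apply' _ _ _
  have hfam : ∀ j, IsHolomorphicFamily U δ M (Ξ j) := by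
    intro j
    induction j with
    | zero => exact ⟨fun _ _ => differentiableOn_const _, fun _ _ => differentiableOn_const _,
        fun _ _ _ _ => by simpa [hΞdef] using hM1⟩
    | succ j ih => rw [hsucc]; exact hK.isHolomorphicFamily_picardStep ih le_rfl hδ
  have hdist : ∀ a ∈ ball (0 : ℂ) δ, ∀ j, ∀ σ ∈ U,
      ‖Ξ j σ a - Ξ (j + 1) σ a‖ ≤ (4 * M) / 2 / 2 ^ j := by
    intro a ha j
    induction j with
    | zero =>
      intro σ hσ
      refine (norm_sub_le _ _).trans ?_
      have h1 := (hfam 0).norm_le σ hσ a ha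
      have h2 := (hfam 1).norm_le σ hσ a ha
      simp only [zero_add, pow_zero]
      linarith
    | succ j ih =>
      intro σ hσ
      rw [hsucc (j + 1), hsucc j]
      refine (hK.norm_picardStep_sub_le (hfam j) ?_ le_rfl hδ hδ0 hδ' ha (e := 4 * M / 2 / 2 ^ j)
        ?_ hσ).trans_eq ?_
      · rw [← hsucc]; exact hfam (j + 1)
      · rw [← hsucc]; exact ih
      · rw [pow_succ]; field_simp
  have hcau : ∀ σ ∈ U, ∀ a ∈ ball (0 : ℂ) δ, ∃ l, Tendsto (fun j => Ξ j σ a) atTop (𝓝 l) :=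
    fun σ hσ a ha => cauchySeq_tendsto_of_complete
      (cauchySeq_of_le_geometric_two (C := 4 * M) fun j => by
        rw [dist_eq_norm]; exact hdist a ha j σ hσ)
  set ξ : ℂ → ℂ → ℂ := fun σ a => limUnder atTop (fun j => Ξ j σ a) with hξ
  have hlim : ∀ σ ∈ U, ∀ a ∈ ball (0 : ℂ) δ, Tendsto (fun j => Ξ j σ a) atTop (𝓝 (ξ σ a)) :=
    fun σ hσ a ha => tendsto_nhds_limUnder (hcau σ hσ a ha)
  have hrate : ∀ σ ∈ U, ∀ a ∈ ball (0 : ℂ) δ, ∀ j, ‖Ξ j σ a - ξ σ a‖ ≤ 4 * M / 2 ^ j := by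
    intro σ hσ a ha j
    rw [← dist_eq_norm]
    exact dist_le_of_le_geometric_two_of_tendsto (C := 4 * M)
      (fun j => by rw [dist_eq_norm]; exact hdist a ha j σ hσ) (hlim σ hσ a ha) j
  have hzero : Tendsto (fun j : ℕ => 4 * M / 2 ^ j) atTop (𝓝 0) :=
    tendsto_const_nhds.div_atTop (tendsto_pow_atTop_atTop_of_one_lt one_lt_two)
  have hunif : ∀ {s : Set ℂ} {F : ℕ → ℂ → ℂ} {g : ℂ → ℂ},
      (∀ z ∈ s, ∀ j, ‖F j z - g z‖ ≤ 4 * M / 2 ^ j) → TendstoLocallyUniformlyOn F g atTop s := by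
    intro s F g h
    refine TendstoUniformlyOn.tendstoLocallyUniformlyOn ?_
    rw [Metric.tendstoUniformlyOn_iff]
    intro e he
    filter_upwards [hzero.eventually (gt_mem_nhds he)] with j hj z hz
    rw [dist_comm, dist_eq_norm]
    exact (h z hz j).trans_lt hj
  have hξfam : IsHolomorphicFamily U δ M ξ := by
    refine ⟨fun a ha => ?_, fun σ hσ => ?_, fun σ hσ a ha => ?_⟩
    · exact (hunif fun σ hσ j => hrate σ hσ a ha j).differentiableOn
        (Eventually.of_forall fun j => (hfam j).time a ha) hK.isOpen
    · exact (hunif fun a ha j => hrate σ hσ a ha j).differentiableOn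
        (Eventually.of_forall fun j => (hfam j).param σ hσ) isOpen_ball
    · exact le_of_tendsto (hlim σ hσ a ha).norm
        (Eventually.of_forall fun j => (hfam j).norm_le σ hσ a ha)
  have hfix : ∀ σ ∈ U, ∀ a ∈ ball (0 : ℂ) δ, picardStep K ξ σ a = ξ σ a := by
    intro σ hσ a ha
    refine tendsto_nhds_unique ?_ ((tendsto_add_atTop_iff_nat 1).2 (hlim σ hσ a ha))
    rw [tendsto_iff_norm_sub_tendsto_zero]
    refine squeeze_zero (fun _ => norm_nonneg _) (fun j => ?_) (by simpa using hzero.div_const 2)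
    rw [hsucc]
    exact hK.norm_picardStep_sub_le (hfam j) hξfam le_rfl hδ hδ0 hδ' ha
      (fun τ hτ => hrate τ hτ a ha j) hσ
  refine ⟨δ, hδ0, M, hM0, ξ, hξfam, ?_, ?_, ?_⟩
  · intro a
    refine Tendsto.limUnder_eq (tendsto_const_nhds.congr fun j => ?_)
    cases j with
    | zero => rfl
    | succ j => simp [hsucc, picardStep]
  · intro σ hσ a ha
    refine ⟨?_, hξfam.mul_mem_ball_radius hM0 hr hδ hσ ha, ?_⟩
    · rw [← hfix σ hσ a ha]; exact Complex.exp_ne_zero _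
    · have h := (hasDerivAt_mul_integral_segment hK.isOpen hK.convex hK.zero_mem
        (hK.differentiableOn_comp_time hξfam hM0 hδ ha) hσ).cexp
      have h' := h.congr_of_eventuallyEq (f₁ := fun σ => ξ σ a) (by
        filter_upwards [hK.isOpen.mem_nhds hσ] with τ hτ using (hfix τ hτ a ha).symm)
      have := hfix σ hσ a ha
      rw [picardStep] at this
      rwa [this, mul_comm] at h'
  · intro η hη hηU hsymm
    have hηball : ∀ a ∈ ball (0 : ℂ) δ, η * a ∈ ball (0 : ℂ) δ := fun a ha => by
      rw [mem_ball_zero_iff] at ha ⊢; rwa [norm_mul, hη, one_mul]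
    -- the symmetry holds for all iterates: substitute it in the integrand
    have hiter : ∀ j, ∀ σ ∈ U, ∀ a ∈ ball (0 : ℂ) δ, Ξ j (η * σ) a = Ξ j σ (η * a) := by
      intro j
      induction j with
      | zero => intro σ _ a _; rfl
      | succ j ih =>
        intro σ hσ a ha
        simp only [hsucc, picardStep]
        congr 1
        rw [mul_assoc, mul_left_comm, ← intervalIntegral.integral_const_mul]
        congr 1
        refine intervalIntegral.integral_congr fun s hs => ?_
        rw [uIcc_of_le zero_le_one] at hs
        have hs' := hK.mul_mem hσ hs
        simp only [mul_left_comm (s : ℂ) η σ, ih _ hs' a ha]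
        rw [hsymm _ _ _ hs', mul_assoc]
        rw [← ih _ hs' a ha]
        exact (hfam j).mul_mem_ball_radius hM0 hr hδ (hηU _ hs') ha
    intro σ hσ a ha
    refine tendsto_nhds_unique (hlim _ (hηU σ hσ) a ha) ?_
    exact (hlim σ hσ _ (hηball a ha)).congr fun j => (hiter j σ hσ a ha).symm

end Picard

/-! ### Holonomy conjugate to a rotation -/

theorem IsGermDiffeo.exists_inverse {φ : ℂ → ℂ} (hφ : IsGermDiffeo φ) :
    ∃ ψ : ℂ → ℂ, IsGermDiffeo ψ ∧ (∀ᶠ a in 𝓝 0, φ (ψ a) = a) ∧ ∀ᶠ b in 𝓝 0, ψ (φ b) = b := by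
  have hs : HasStrictDerivAt φ (deriv φ 0) 0 := hφ.analyticAt.hasStrictDerivAt
  have hψ := hφ.analyticAt.analyticAt_localInverse hφ.deriv_ne_zero
  have hd := hs.to_localInverse hφ.deriv_ne_zero
  have hr := hs.hasStrictFDerivAt_equiv hφ.deriv_ne_zero |>.eventually_right_inverse
  have hl := hs.hasStrictFDerivAt_equiv hφ.deriv_ne_zero |>.eventually_left_inverse
  have h0 := hs.hasStrictFDerivAt_equiv hφ.deriv_ne_zero |>.localInverse_apply_image
  rw [hφ.map_zero] at hψ hd hr h0
  refine ⟨_, ⟨hψ, h0, ?_⟩, hr, hl⟩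
  rw [hd.hasDerivAt.deriv]
  exact inv_ne_zero hφ.deriv_ne_zero

/-- A germ which a local diffeomorphism `ψ` conjugates to the rotation `w ↦ c w`, `c ^ m = 1`, is
periodic. -/
theorem IsGermDiffeo.periodic_of_semiconj {ψ g : ℂ → ℂ} {c : ℂ} {m : ℕ} (hψ : IsGermDiffeo ψ)
    (hg : IsGermDiffeo g) (hc : c ^ m = 1) (h : ∀ᶠ w in 𝓝 0, ψ (g w) = c * ψ w) :
    (∀ᶠ w in 𝓝 0, g^[m] w = w) ∧ deriv g 0 = c := by
  have hg0 : Tendsto g (𝓝 0) (𝓝 0) := by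
    simpa [hg.map_zero] using hg.analyticAt.continuousAt.tendsto
  have hiter : ∀ j, Tendsto g^[j] (𝓝 0) (𝓝 0) ∧ ∀ᶠ w in 𝓝 0, ψ (g^[j] w) = c ^ j * ψ w := by
    intro j
    induction j with
    | zero => exact ⟨tendsto_id, by simp⟩
    | succ j ih =>
      refine ⟨by rw [Function.iterate_succ']; exact hg0.comp ih.1, ?_⟩
      filter_upwards [ih.1.eventually h, ih.2] with w h1 h2
      rw [Function.iterate_succ_apply', h1, h2, pow_succ]
      ring
  obtain ⟨φ, -, -, hleft⟩ := hψ.exists_inverse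
  refine ⟨?_, ?_⟩
  · filter_upwards [(hiter m).2, (hiter m).1.eventually hleft, hleft] with w h1 h2 h3
    rw [← h2, h1, hc, one_mul, h3]
  · have h1 : HasDerivAt (fun w => ψ (g w)) (deriv ψ 0 * deriv g 0) 0 := by
      refine HasDerivAt.comp (h₂ := ψ) 0 ?_ hg.analyticAt.differentiableAt.hasDerivAt
      rw [hg.map_zero]
      exact hψ.analyticAt.differentiableAt.hasDerivAt
    have h2 : HasDerivAt (fun w => c * ψ w) (c * deriv ψ 0) 0 :=
      hψ.analyticAt.differentiableAt.hasDerivAt.const_mul c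
    have := (h1.congr_of_eventuallyEq (h.mono fun w hw => hw.symm)).unique h2
    rw [mul_comm] at this
    exact mul_right_cancel₀ hψ.deriv_ne_zero this

/-- In the tube `‖x‖ < r`, the lifts of `γ` are the solutions of the equation `x' = v s x`. -/
structure LiftsSolve (η : OneForm) (n : ℕ) (γ : ℝ → ℂ × ℂ) (r : ℝ) (v : ℝ → ℂ → ℂ) : Prop where
  lipschitz : ∃ L, ∀ s ∈ Ico (0 : ℝ) 1, LipschitzOnWith L (v s) (ball 0 r)
  tangent_iff : ∀ s ∈ Ico (0 : ℝ) 1, ∀ x : ℝ → ℂ, x s ≠ 0 → ‖x s‖ < r →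
    ((∃ w : C3, HasDerivWithinAt (fun τ => blowDown n (x τ) (γ τ)) w (Ici s) s ∧
        η (blowDown n (x s) (γ s)) w = 0) ↔
      HasDerivWithinAt x (v s (x s)) (Ici s) s)

/-- `X b`, for small `b ≠ 0`, is a solution of `x' = v s x` along which `x` goes from `φ b` to
`φ (c b)`. -/
structure UniformizingFamily (v : ℝ → ℂ → ℂ) (δ M : ℝ) (X : ℂ → ℝ → ℂ) (φ : ℂ → ℂ) (c : ℂ) :
    Prop where
  continuousOn : ∀ b ∈ ball (0 : ℂ) δ, ContinuousOn (X b) (Icc 0 1)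
  ne_zero : ∀ b ∈ ball (0 : ℂ) δ, b ≠ 0 → ∀ s ∈ Icc (0 : ℝ) 1, X b s ≠ 0
  norm_le : ∀ b ∈ ball (0 : ℂ) δ, ∀ s ∈ Icc (0 : ℝ) 1, ‖X b s‖ ≤ M * ‖b‖
  hasDeriv : ∀ b ∈ ball (0 : ℂ) δ, ∀ s ∈ Ico (0 : ℝ) 1,
    HasDerivWithinAt (X b) (v s (X b s)) (Ici s) s
  start : ∀ b ∈ ball (0 : ℂ) δ, X b 0 = φ b
  finish : ∀ b ∈ ball (0 : ℂ) δ, X b 1 = φ (c * b)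

/-- If the lifts of `γ` join `φ b` to `φ (c b)` with `c ^ m = 1`, then the holonomy is conjugate
by `φ` to the multiplication by `c`. -/
theorem UniformizingFamily.hasPeriodicHolonomy {η : OneForm} {n m : ℕ} {γ : ℝ → ℂ × ℂ} {r : ℝ}
    {v : ℝ → ℂ → ℂ} {δ M : ℝ} {X : ℂ → ℝ → ℂ} {φ : ℂ → ℂ} {c : ℂ}
    (hX : UniformizingFamily v δ M X φ c) (hv : LiftsSolve η n γ r v) (hr : 0 < r) (hδ : 0 < δ)
    (hφ : IsGermDiffeo φ) (hm : m ≠ 0) (hc : c ^ m = 1) :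
    HasPeriodicHolonomy η n γ m c := by
  obtain ⟨ψ, hψ, hright, hleft⟩ := hφ.exists_inverse
  have hc0 : c ≠ 0 := by rintro rfl; simp [hm] at hc
  obtain ⟨L, hL⟩ := hv.lipschitz
  set g₀ : ℂ → ℂ := fun a => φ (c * ψ a) with hg₀
  have hψ0 : Tendsto ψ (𝓝 0) (𝓝 0) := by
    simpa [hψ.map_zero] using hψ.analyticAt.continuousAt.tendsto
  have hcψ0 : Tendsto (fun a => c * ψ a) (𝓝 0) (𝓝 0) := by simpa using hψ0.const_mul c
  have hgerm : IsGermDiffeo g₀ := by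
    have hψd := hψ.analyticAt.differentiableAt.hasDerivAt.const_mul c
    have h0 : c * ψ 0 = 0 := by simp [hψ.map_zero]
    have han : AnalyticAt ℂ (fun a => c * ψ a) 0 := analyticAt_const.mul hψ.analyticAt
    refine ⟨?_, ?_, ?_⟩
    · exact AnalyticAt.fun_comp (by rw [h0]; exact hφ.analyticAt) han
    · simp [hg₀, hψ.map_zero, hφ.map_zero]
    · have : HasDerivAt g₀ (deriv φ 0 * (c * deriv ψ 0)) 0 :=
        HasDerivAt.comp (h₂ := φ) 0 (by
          rw [h0]; exact hφ.analyticAt.differentiableAt.hasDerivAt) hψd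
      rw [this.deriv]
      exact mul_ne_zero hφ.deriv_ne_zero (mul_ne_zero hc0 hψ.deriv_ne_zero)
  have hlifts : ∀ᶠ ρ in 𝓝[>] (0 : ℝ), ∀ᶠ a in 𝓝[≠] (0 : ℂ),
      (∃ x : ℝ → ℂ, IsLift η n γ x ∧ x 0 = a ∧ ∀ s ∈ Icc (0 : ℝ) 1, ‖x s‖ < ρ) ∧
      ∀ x : ℝ → ℂ, IsLift η n γ x → x 0 = a → (∀ s ∈ Icc (0 : ℝ) 1, ‖x s‖ < ρ) →
        x 1 = g₀ a := by
    filter_upwards [Ioo_mem_nhdsGT hr] with ρ hρ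
    have hsmall : ∀ᶠ a in 𝓝 (0 : ℂ), ψ a ∈ ball (0 : ℂ) δ ∧ M * ‖ψ a‖ < ρ := by
      refine (hψ0.eventually (ball_mem_nhds 0 hδ)).and ?_
      have : Tendsto (fun a => M * ‖ψ a‖) (𝓝 0) (𝓝 0) := by simpa using hψ0.norm.const_mul M
      exact this.eventually (gt_mem_nhds hρ.1)
    filter_upwards [hsmall.filter_mono nhdsWithin_le_nhds, hright.filter_mono nhdsWithin_le_nhds,
      self_mem_nhdsWithin] with a ⟨hb, hbM⟩ hinv ha
    have hb0 : ψ a ≠ 0 := by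
      intro h
      rw [h, hφ.map_zero] at hinv
      exact ha hinv.symm
    have hXnorm : ∀ s ∈ Icc (0 : ℝ) 1, ‖X (ψ a) s‖ < ρ := fun s hs =>
      (hX.norm_le _ hb s hs).trans_lt hbM
    refine ⟨⟨X (ψ a), ⟨hX.continuousOn _ hb, hX.ne_zero _ hb hb0, fun s hs => ?_⟩, ?_, hXnorm⟩, ?_⟩
    · have hs' := Ico_subset_Icc_self hs
      exact (hv.tangent_iff s hs _ (hX.ne_zero _ hb hb0 s hs')
        ((hXnorm s hs').trans hρ.2)).2 (hX.hasDeriv _ hb s hs)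
    · rw [hX.start _ hb, hinv]
    · intro x hx hxa hxρ
      have heq := ODE_solution_unique_of_mem_Icc_right (v := v) (s := fun _ => ball 0 r)
        (f := x) (g := X (ψ a)) (a := 0) (b := 1) hL hx.continuousOn
        (fun s hs => (hv.tangent_iff s hs x (hx.ne_zero s (Ico_subset_Icc_self hs))
          ((hxρ s (Ico_subset_Icc_self hs)).trans hρ.2)).1 (hx.tangent s hs))
        (fun s hs => mem_ball_zero_iff.2 ((hxρ s (Ico_subset_Icc_self hs)).trans hρ.2))
        (hX.continuousOn _ hb) (hX.hasDeriv _ hb)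
        (fun s hs => mem_ball_zero_iff.2 ((hXnorm s (Ico_subset_Icc_self hs)).trans hρ.2))
        (by rw [hxa, hX.start _ hb, hinv])
      rw [heq (right_mem_Icc.2 zero_le_one), hX.finish _ hb]
  refine ⟨⟨g₀, hgerm, hlifts⟩, fun g hg => ?_⟩
  -- any other germ with the lifting property agrees with `g₀`, since both follow the same lifts
  have hgg₀ : ∀ᶠ a in 𝓝 (0 : ℂ), g a = g₀ a := by
    obtain ⟨ρ, h1, h2⟩ := (hlifts.and hg.lifts).exists
    have hne : ∀ᶠ a in 𝓝[≠] (0 : ℂ), g a = g₀ a := by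
      filter_upwards [h1, h2] with a ⟨⟨x, hx, hxa, hxρ⟩, h1⟩ ⟨_, h2⟩
      rw [← h1 x hx hxa hxρ, ← h2 x hx hxa hxρ]
    rw [eventually_nhdsWithin_iff] at hne
    filter_upwards [hne] with a ha
    by_cases h0 : a = 0
    · rw [h0, hg.germDiffeo.map_zero, hgerm.map_zero]
    · exact ha h0
  have hsemi : ∀ᶠ w in 𝓝 (0 : ℂ), ψ (g w) = c * ψ w := by
    filter_upwards [hgg₀, hcψ0.eventually hleft] with w h1 h2
    rw [h1, hg₀, h2]
  obtain ⟨hper, hder⟩ := hψ.periodic_of_semiconj hg.germDiffeo hc hsemi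
  exact ⟨hper, hder, ψ, hψ, hsemi⟩

/-! ### The strict transform of the model form -/

/-- On the ball of radius `ρ` the foliation `η = 0` is the one defined by the model form, and
`f` is holomorphic and bounded by `C` on the disc of radius `ρ`. The bound `ρ ≤ 1` makes every
monomial of positive degree at most as large as each of its variables. -/
structure IsModelBall (p q k : ℕ) (f : ℂ → ℂ) (η : OneForm) (ρ C : ℝ) : Prop where
  pos : 0 < ρ
  le_one : ρ ≤ 1
  bound_nonneg : 0 ≤ C
  differentiableOn : DifferentiableOn ℂ f (ball 0 ρ)
  norm_le : ∀ u ∈ ball (0 : ℂ) ρ, ‖f u‖ ≤ C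
  eq_zero_iff : ∀ P ∈ ball (0 : C3) ρ, ∀ w, η P w = 0 ↔ modelForm p q k f P w = 0

theorem IsModelChart.exists_isModelBall {p q k : ℕ} {f : ℂ → ℂ} {ω : OneForm} {Φ : C3 → C3}
    (h : IsModelChart p q k f ω Φ) (hf : AnalyticAt ℂ f 0) :
    ∃ ρ C, IsModelBall p q k f (pullback Φ ω) ρ C := by
  obtain ⟨u, hu, hu0, heq⟩ := h.pullback_eq
  obtain ⟨ρ₁, hρ₁, h₁⟩ := Metric.eventually_nhds_iff_ball.1
    (heq.and (hu.continuousAt.eventually_ne hu0))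
  have hfb : ∀ᶠ z in 𝓝 (0 : ℂ), ‖f z‖ ≤ ‖f 0‖ + 1 :=
    (hf.continuousAt.norm.eventually (gt_mem_nhds (lt_add_one _))).mono fun _ => le_of_lt
  obtain ⟨ρ₂, hρ₂, h₂⟩ := Metric.eventually_nhds_iff_ball.1 (hf.eventually_analyticAt.and hfb)
  refine ⟨min 1 (min ρ₁ ρ₂), ‖f 0‖ + 1, by positivity, min_le_left _ _, by positivity, ?_, ?_, ?_⟩
  · intro z hz
    exact (h₂ z (ball_subset_ball ((min_le_right _ _).trans (min_le_right _ _)) hz)).1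
      |>.differentiableAt.differentiableWithinAt
  · intro z hz
    exact (h₂ z (ball_subset_ball ((min_le_right _ _).trans (min_le_right _ _)) hz)).2
  · intro P hP w
    obtain ⟨h3, h4⟩ := h₁ P (ball_subset_ball ((min_le_right _ _).trans (min_le_left _ _)) hP)
    rw [h3]
    simp [h4]

/-- The factor `E` such that `u ^ k * f u = x ^ n * E`, where `u = x ^ p' * y ^ q'` and
`n ≤ k * p'`. -/
noncomputable def perturbation (p q k n : ℕ) (f : ℂ → ℂ) (x y : ℂ) : ℂ :=
  x ^ (k * (p / Nat.gcd p q) - n) * y ^ (k * (q / Nat.gcd p q)) *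
    f (x ^ (p / Nat.gcd p q) * y ^ (q / Nat.gcd p q))

/-- The coefficient of `dx` in the strict transform of the model form in the chart `(x, y, t)`,
divided by `x ^ (2 * n - 1)`. -/
noncomputable def dxCoeff (p q k n : ℕ) (f : ℂ → ℂ) (x y t : ℂ) : ℂ :=
  n * (t * (2 * t + perturbation p q k n f x y)) + p * (x ^ (p - 2 * n) * y ^ q)

/-- The logarithmic derivative of `x` along the leaf over a path which leaves `(y, t)` with
velocity `(y', t')`. -/
noncomputable def leafSlope (p q k n : ℕ) (f : ℂ → ℂ) (x : ℂ) (b b' : ℂ × ℂ) : ℂ :=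
  -((2 * b.2 + perturbation p q k n f x b.1) * b'.2 +
      q * (x ^ (p - 2 * n) * b.1 ^ (q - 1) * b'.1)) / dxCoeff p q k n f x b.1 b.2

theorem modelForm_apply (p q k : ℕ) (f : ℂ → ℂ) (P w : C3) :
    modelForm p q k f P w = 2 * P.2.2 * w.2.2 +
      (p * P.1 ^ (p - 1) * w.1 * P.2.1 ^ q + P.1 ^ p * (q * P.2.1 ^ (q - 1) * w.2.1)) +
      (P.1 ^ (p / Nat.gcd p q) * P.2.1 ^ (q / Nat.gcd p q)) ^ k *
        f (P.1 ^ (p / Nat.gcd p q) * P.2.1 ^ (q / Nat.gcd p q)) * w.2.2 := by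
  have h1 : HasFDerivAt (fun Q : C3 => Q.1) (ContinuousLinearMap.fst ℂ ℂ (ℂ × ℂ)) P :=
    hasFDerivAt_fst
  have h2 : HasFDerivAt (fun Q : C3 => Q.2.1)
      ((ContinuousLinearMap.fst ℂ ℂ ℂ).comp (ContinuousLinearMap.snd ℂ ℂ (ℂ × ℂ))) P :=
    hasFDerivAt_fst.comp P hasFDerivAt_snd
  have h3 : HasFDerivAt (fun Q : C3 => Q.2.2)
      ((ContinuousLinearMap.snd ℂ ℂ ℂ).comp (ContinuousLinearMap.snd ℂ ℂ (ℂ × ℂ))) P :=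
    hasFDerivAt_snd.comp P hasFDerivAt_snd
  have h := (h3.pow 2).fun_add ((h1.pow p).fun_mul (h2.pow q))
  rw [modelForm, h.fderiv, h3.fderiv]
  simp
  ring

/-- The pull-back of the model form to the chart `(x, y, t)`, evaluated on the velocity
`(x', y', t')`. -/
theorem modelForm_blowDown {p q k n : ℕ} (hn : 0 < n) (hpn : 2 * n ≤ p)
    (hkn : n ≤ k * (p / Nat.gcd p q)) (f : ℂ → ℂ) (x x' : ℂ) (b b' : ℂ × ℂ) :
    modelForm p q k f (blowDown n x b)
        (x', b'.1, n * x ^ (n - 1) * x' * b.2 + x ^ n * b'.2) =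
      x ^ (2 * n - 1) * (dxCoeff p q k n f x b.1 b.2 * x' +
        x * ((2 * b.2 + perturbation p q k n f x b.1) * b'.2 +
          q * (x ^ (p - 2 * n) * b.1 ^ (q - 1) * b'.1))) := by
  obtain ⟨y, t⟩ := b
  obtain ⟨y', t'⟩ := b'
  have hu : (x ^ (p / Nat.gcd p q) * y ^ (q / Nat.gcd p q)) ^ k *
      f (x ^ (p / Nat.gcd p q) * y ^ (q / Nat.gcd p q)) =
      x ^ n * perturbation p q k n f x y := by
    rw [perturbation, mul_pow, ← pow_mul, ← pow_mul, mul_comm (p / _) k, mul_comm (q / _) k]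
    conv_lhs => rw [← Nat.add_sub_cancel' hkn, pow_add]
    ring
  rw [modelForm_apply]
  simp only [blowDown, dxCoeff]
  rw [hu]
  obtain ⟨N, rfl⟩ : ∃ N, n = N + 1 := ⟨n - 1, by omega⟩
  obtain ⟨e, rfl⟩ : ∃ e, p = 2 * (N + 1) + e := ⟨p - 2 * (N + 1), by omega⟩
  rw [show 2 * (N + 1) + e - 1 = 2 * N + 1 + e by omega,
    show 2 * (N + 1) + e - 2 * (N + 1) = e by omega,
    show 2 * (N + 1) - 1 = 2 * N + 1 by omega, Nat.add_sub_cancel]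
  ring

theorem hasDerivWithinAt_blowDown {n : ℕ} {γ : ℝ → ℂ × ℂ} {x : ℝ → ℂ} {s : ℝ} {x' : ℂ}
    {b' : ℂ × ℂ} (hγ : HasDerivWithinAt γ b' (Ici s) s) (hx : HasDerivWithinAt x x' (Ici s) s) :
    HasDerivWithinAt (fun τ => blowDown n (x τ) (γ τ))
      (x', b'.1, n * x s ^ (n - 1) * x' * (γ s).2 + x s ^ n * b'.2) (Ici s) s := by
  have hy : HasDerivWithinAt (fun τ => (γ τ).1) b'.1 (Ici s) s :=
    (hasFDerivAt_fst (𝕜 := ℝ) (p := γ s)).comp_hasDerivWithinAt s hγ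
  have ht : HasDerivWithinAt (fun τ => (γ τ).2) b'.2 (Ici s) s :=
    (hasFDerivAt_snd (𝕜 := ℝ) (p := γ s)).comp_hasDerivWithinAt s hγ
  exact hx.prodMk (hy.prodMk ((hx.fun_pow n).fun_mul ht))

/-- A path with `x ≠ 0` is tangent to the foliation exactly when `x` follows the slope of the
leaves. -/
theorem IsModelBall.tangent_iff {p q k n : ℕ} {f : ℂ → ℂ} {η : OneForm} {ρ C : ℝ}
    (hη : IsModelBall p q k f η ρ C) (hn : 0 < n) (hpn : 2 * n ≤ p)
    (hkn : n ≤ k * (p / Nat.gcd p q)) {γ : ℝ → ℂ × ℂ} {x : ℝ → ℂ} {s : ℝ} {b' : ℂ × ℂ}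
    (hγ : HasDerivWithinAt γ b' (Ici s) s) (hmem : blowDown n (x s) (γ s) ∈ ball (0 : C3) ρ)
    (hx : x s ≠ 0) (hD : dxCoeff p q k n f (x s) (γ s).1 (γ s).2 ≠ 0) :
    (∃ w : C3, HasDerivWithinAt (fun τ => blowDown n (x τ) (γ τ)) w (Ici s) s ∧
        η (blowDown n (x s) (γ s)) w = 0) ↔
      HasDerivWithinAt x (x s * leafSlope p q k n f (x s) (γ s) b') (Ici s) s := by
  constructor
  · rintro ⟨w, hw, hηw⟩
    have hx' : HasDerivWithinAt x w.1 (Ici s) s :=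
      (hasFDerivAt_fst (𝕜 := ℝ) (F := ℂ × ℂ) (p := blowDown n (x s) (γ s))).comp_hasDerivWithinAt s
        (f := fun τ => blowDown n (x τ) (γ τ)) hw
    have hw' := (uniqueDiffWithinAt_Ici s).eq_deriv _ hw (hasDerivWithinAt_blowDown hγ hx')
    rw [hη.eq_zero_iff _ hmem, hw', modelForm_blowDown hn hpn hkn,
      mul_eq_zero_iff_left (pow_ne_zero _ hx)] at hηw
    convert hx' using 1
    rw [leafSlope, mul_div_assoc', div_eq_iff hD]
    linear_combination -hηw
  · intro h
    refine ⟨_, hasDerivWithinAt_blowDown hγ h, ?_⟩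
    rw [hη.eq_zero_iff _ hmem, modelForm_blowDown hn hpn hkn, leafSlope]
    field_simp
    ring

theorem gcd_quotients_pos {p q : ℕ} (hp : 0 < p) (hq : 0 < q) :
    0 < p / Nat.gcd p q ∧ 0 < q / Nat.gcd p q :=
  ⟨Nat.div_pos (Nat.gcd_le_left q hp) (Nat.gcd_pos_of_pos_left q hp),
    Nat.div_pos (Nat.gcd_le_right p hq) (Nat.gcd_pos_of_pos_left q hp)⟩

section Estimates

variable {p q k n : ℕ} {f : ℂ → ℂ} {η : OneForm} {ρ C : ℝ}

theorem IsModelBall.monomial_mem (hη : IsModelBall p q k f η ρ C) (hp : 0 < p) (hq : 0 < q)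
    {x y : ℂ} (hx : ‖x‖ < ρ) (hy : ‖y‖ ≤ 1) :
    x ^ (p / Nat.gcd p q) * y ^ (q / Nat.gcd p q) ∈ ball (0 : ℂ) ρ := by
  obtain ⟨h1, -⟩ := gcd_quotients_pos hp hq
  have hle := hη.le_one
  rw [mem_ball_zero_iff, norm_mul, norm_pow, norm_pow]
  calc _ ≤ ‖x‖ ^ (p / Nat.gcd p q) * 1 := by
        gcongr; exact pow_le_one₀ (norm_nonneg _) hy
    _ ≤ ‖x‖ := by
        rw [mul_one]
        exact pow_le_of_le_one (norm_nonneg _) (by linarith) h1.ne'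
    _ < ρ := hx

theorem IsModelBall.norm_perturbation_le (hη : IsModelBall p q k f η ρ C) (hp : 0 < p)
    (hq : 0 < q) (hk : 0 < k) {x y : ℂ} (hx : ‖x‖ < ρ) (hy : ‖y‖ ≤ 1) :
    ‖perturbation p q k n f x y‖ ≤ ‖x‖ ^ (k * (p / Nat.gcd p q) - n) * (‖y‖ * C) := by
  obtain ⟨-, h2⟩ := gcd_quotients_pos hp hq
  rw [perturbation, norm_mul, norm_mul, norm_pow, norm_pow, mul_assoc]
  gcongr
  · exact pow_le_of_le_one (norm_nonneg _) hy (Nat.mul_pos hk h2).ne'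
  · exact hη.norm_le _ (hη.monomial_mem hp hq hx hy)

theorem IsModelBall.differentiableOn_perturbation (hη : IsModelBall p q k f η ρ C) (hp : 0 < p)
    (hq : 0 < q) {y : ℂ} (hy : ‖y‖ ≤ 1) :
    DifferentiableOn ℂ (fun x => perturbation p q k n f x y) (ball 0 ρ) := by
  refine DifferentiableOn.mul (by fun_prop) ?_
  exact hη.differentiableOn.comp (by fun_prop)
    fun x hx => hη.monomial_mem hp hq (mem_ball_zero_iff.1 hx) hy

theorem blowDown_mem_ball (hρ : ρ ≤ 1) (hn : 0 < n) {x : ℂ} {b : ℂ × ℂ} (hx : ‖x‖ < ρ)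
    (hy : ‖b.1‖ < ρ) (ht : ‖b.2‖ ≤ 1) : blowDown n x b ∈ ball (0 : C3) ρ := by
  rw [mem_ball_zero_iff, blowDown, Prod.norm_def, Prod.norm_def]
  refine max_lt hx (max_lt hy ?_)
  rw [norm_mul, norm_pow]
  calc _ ≤ ‖x‖ ^ n * 1 := by gcongr
    _ ≤ ‖x‖ := by
      rw [mul_one]; exact pow_le_of_le_one (norm_nonneg _) (by linarith) hn.ne'
    _ < ρ := hx

/-- Over a path along which the coefficient of `dx` does not vanish and the slope of the leaves
is bounded, the lifts are the solutions of a Lipschitz equation. -/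
theorem IsModelBall.liftsSolve (hη : IsModelBall p q k f η ρ C) (hp : 0 < p) (hq : 0 < q)
    (hn : 0 < n) (hpn : 2 * n ≤ p) (hkn : n ≤ k * (p / Nat.gcd p q)) {γ γ' : ℝ → ℂ × ℂ}
    (hγ : ∀ s ∈ Ico (0 : ℝ) 1, HasDerivWithinAt γ (γ' s) (Ici s) s)
    (hy : ∀ s ∈ Ico (0 : ℝ) 1, ‖(γ s).1‖ < ρ) (ht : ∀ s ∈ Ico (0 : ℝ) 1, ‖(γ s).2‖ ≤ 1)
    {r A : ℝ} (hr : 0 < r) (hrρ : r ≤ ρ) (hA : 0 ≤ A)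
    (hD : ∀ s ∈ Ico (0 : ℝ) 1, ∀ x ∈ ball (0 : ℂ) r, dxCoeff p q k n f x (γ s).1 (γ s).2 ≠ 0)
    (hslope : ∀ s ∈ Ico (0 : ℝ) 1, ∀ x ∈ ball (0 : ℂ) r,
      ‖leafSlope p q k n f x (γ s) (γ' s)‖ ≤ A) :
    LiftsSolve η n γ (r / 2) (fun s x => x * leafSlope p q k n f x (γ s) (γ' s)) := by
  refine ⟨⟨(4 * (r * A) / r).toNNReal, fun s hs => ?_⟩, fun s hs x hx0 hxr => ?_⟩
  · have hE := (hη.differentiableOn_perturbation (n := n) hp hq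
      ((hy s hs).le.trans hη.le_one)).mono (ball_subset_ball hrρ)
    refine lipschitzOnWith_of_bounded_holomorphic hr (by positivity) ?_ fun x hx => ?_
    · refine differentiableOn_id.mul (DifferentiableOn.div ?_ ?_ (hD s hs))
      · exact (((hE.const_add _).mul_const _).add (by fun_prop)).neg
      · exact (((hE.const_add _).const_mul _).const_mul _).add (by fun_prop)
    · rw [norm_mul]
      exact mul_le_mul (mem_ball_zero_iff.1 hx).le (hslope s hs x hx) (norm_nonneg _) hr.le
  · have hxr' : ‖x s‖ < r := by linarith
    exact hη.tangent_iff hn hpn hkn (hγ s hs)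
      (blowDown_mem_ball hη.le_one hn (hxr'.trans_le hrρ) (hy s hs) (ht s hs)) hx0
      (hD s hs _ (mem_ball_zero_iff.2 hxr'))

end Estimates

/-! ### The loop around infinity -/

theorem isGermDiffeo_id_mul {g : ℂ → ℂ} {δ : ℝ} (hδ : 0 < δ)
    (hg : DifferentiableOn ℂ g (ball 0 δ)) (h0 : g 0 ≠ 0) : IsGermDiffeo fun b => b * g b := by
  have hga : AnalyticAt ℂ g 0 := hg.analyticAt (ball_mem_nhds 0 hδ)
  refine ⟨analyticAt_id.mul hga, zero_mul _, ?_⟩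
  have : HasDerivAt (fun b => b * g b) (1 * g 0 + 0 * deriv g 0) 0 :=
    (hasDerivAt_id (0 : ℂ)).mul hga.differentiableAt.hasDerivAt
  rw [this.deriv]
  simpa using h0

/-- The coefficient `dxCoeff` in the coordinate `σ = t ^ (-1 / n)` near `t = ∞`, multiplied by
`σ ^ (2 * n)`. -/
noncomputable def outerDen (p q k n : ℕ) (f : ℂ → ℂ) (y x σ : ℂ) : ℂ :=
  n * (2 + perturbation p q k n f x y * σ ^ n) + p * (x ^ (p - 2 * n) * y ^ q) * σ ^ (2 * n)

/-- The field `K` such that the leaves in the plane `y = const`, written `x = σ * X` with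
`t = σ ^ (-n)`, are the solutions of `dX = X * K X σ dσ`. It is regular at `σ = 0`, which is the
point `t = ∞`. -/
noncomputable def outerField (p q k n : ℕ) (f : ℂ → ℂ) (y X σ : ℂ) : ℂ :=
  -(p * ((σ * X) ^ (p - 2 * n) * y ^ q) * σ ^ (2 * n - 1)) / outerDen p q k n f y (σ * X) σ

section Alpha

variable {p q k n : ℕ} {f : ℂ → ℂ} {η : OneForm} {ρ C ε : ℝ}

theorem norm_monomial_le {x y : ℂ} (hq : 0 < q) (hx : ‖x‖ ≤ 1) (hy : ‖y‖ ≤ 1) (e : ℕ) :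
    ‖x ^ e * y ^ q‖ ≤ ‖y‖ := by
  rw [norm_mul, norm_pow, norm_pow]
  calc _ ≤ 1 * ‖y‖ := by
        gcongr
        · exact pow_le_one₀ (norm_nonneg _) hx
        · exact pow_le_of_le_one (norm_nonneg _) hy hq.ne'
    _ = ‖y‖ := one_mul _

theorem IsModelBall.norm_perturbation_le_norm_mul (hη : IsModelBall p q k f η ρ C) (hp : 0 < p)
    (hq : 0 < q) (hk : 0 < k) {x y : ℂ} (hx : ‖x‖ < ρ) (hy : ‖y‖ ≤ 1) :
    ‖perturbation p q k n f x y‖ ≤ ‖y‖ * C := by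
  refine (hη.norm_perturbation_le hp hq hk hx hy).trans ?_
  have := hη.bound_nonneg
  exact mul_le_of_le_one_left (by positivity)
    (pow_le_one₀ (norm_nonneg _) (hx.le.trans hη.le_one))

/-- For small `y` the term `2 * n` dominates `outerDen` on the whole disc `‖σ‖ ≤ 2`. -/
theorem IsModelBall.le_norm_outerDen (hη : IsModelBall p q k f η ρ C) (hp : 0 < p)
    (hq : 0 < q) (hk : 0 < k) (hn : 0 < n) {y : ℂ} (hy : ‖y‖ ≤ 1)
    (hsmall : ‖y‖ * (C + p) * 4 ^ n ≤ 1) {x σ : ℂ} (hx : ‖x‖ < ρ) (hσ : ‖σ‖ ≤ 2) :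
    1 ≤ ‖outerDen p q k n f y x σ‖ := by
  have hC := hη.bound_nonneg
  have hn1 : (1 : ℝ) ≤ n := by exact_mod_cast hn
  have hE := hη.norm_perturbation_le_norm_mul (n := n) hp hq hk hx hy
  have hB := norm_monomial_le hq (hx.le.trans hη.le_one) hy (p - 2 * n)
  have h2 : ‖σ‖ ^ n ≤ 4 ^ n := by gcongr; linarith
  have h4 : ‖σ‖ ^ (2 * n) ≤ 4 ^ n := by
    rw [pow_mul]; gcongr; nlinarith [norm_nonneg σ]
  have h1 : ‖n * (perturbation p q k n f x y * σ ^ n)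
      + p * (x ^ (p - 2 * n) * y ^ q) * σ ^ (2 * n)‖ ≤ n := by
    calc _ ≤ ‖n * (perturbation p q k n f x y * σ ^ n)‖
        + ‖p * (x ^ (p - 2 * n) * y ^ q) * σ ^ (2 * n)‖ := norm_add_le _ _
      _ = n * (‖perturbation p q k n f x y‖ * ‖σ‖ ^ n)
        + p * ‖x ^ (p - 2 * n) * y ^ q‖ * ‖σ‖ ^ (2 * n) := by simp
      _ ≤ n * (‖y‖ * C * 4 ^ n) + p * ‖y‖ * 4 ^ n := by gcongr
      _ ≤ n * (‖y‖ * C * 4 ^ n) + n * (p * ‖y‖ * 4 ^ n) := by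
        have : 0 ≤ p * ‖y‖ * 4 ^ n := by positivity
        linarith [le_mul_of_one_le_left this hn1]
      _ = n * (‖y‖ * (C + p) * 4 ^ n) := by ring
      _ ≤ n * 1 := by gcongr
      _ = n := mul_one _
  have h3 : outerDen p q k n f y x σ = (2 * n : ℂ) - -(n * (perturbation p q k n f x y * σ ^ n)
      + p * (x ^ (p - 2 * n) * y ^ q) * σ ^ (2 * n)) := by rw [outerDen]; ring
  have h5 := norm_sub_norm_le (2 * n : ℂ) (-(n * (perturbation p q k n f x y * σ ^ n)
      + p * (x ^ (p - 2 * n) * y ^ q) * σ ^ (2 * n)))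
  rw [← h3, norm_neg] at h5
  have h6 : ‖(2 * n : ℂ)‖ = 2 * n := by simp
  linarith

theorem IsModelBall.isBoundedField_outerField (hη : IsModelBall p q k f η ρ C) (hp : 0 < p)
    (hq : 0 < q) (hk : 0 < k) (hn : 0 < n) {y : ℂ} (hy : ‖y‖ ≤ 1)
    (hsmall : ‖y‖ * (C + p) * 4 ^ n ≤ 1) :
    IsBoundedField (ball 0 2) 2 (ρ / 2) 1 (outerField p q k n f y) := by
  have hρ := hη.pos
  have hC := hη.bound_nonneg
  have hmul : ∀ P ∈ ball (0 : ℂ) (ρ / 2) ×ˢ ball (0 : ℂ) 2, P.2 * P.1 ∈ ball (0 : ℂ) ρ := by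
    rintro ⟨X, σ⟩ ⟨hX, hσ⟩
    simp only [mem_ball_zero_iff] at hX hσ ⊢
    rw [norm_mul]
    nlinarith [norm_nonneg X, norm_nonneg σ]
  have hden : ∀ P ∈ ball (0 : ℂ) (ρ / 2) ×ˢ ball (0 : ℂ) 2,
      1 ≤ ‖outerDen p q k n f y (P.2 * P.1) P.2‖ := fun P hP =>
    hη.le_norm_outerDen hp hq hk hn hy hsmall (mem_ball_zero_iff.1 (hmul P hP))
      (mem_ball_zero_iff.1 hP.2).le
  refine ⟨isOpen_ball, convex_ball _ _, mem_ball_self two_pos,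
    fun σ hσ => (mem_ball_zero_iff.1 hσ).le, by positivity, zero_le_one, ?_, ?_⟩
  · have hE : DifferentiableOn ℂ (fun P : ℂ × ℂ => perturbation p q k n f (P.2 * P.1) y)
        (ball 0 (ρ / 2) ×ˢ ball 0 2) :=
      (hη.differentiableOn_perturbation hp hq hy).comp (f := fun P : ℂ × ℂ => P.2 * P.1)
        (by fun_prop) hmul
    unfold outerField
    simp only [div_eq_mul_inv]
    refine DifferentiableOn.fun_mul ?_ (DifferentiableOn.fun_inv ?_ fun P hP h => ?_)
    · fun_prop
    · unfold outerDen
      exact (((hE.mul (by fun_prop)).const_add _).const_mul _).add (by fun_prop)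
    · have := hden P hP
      rw [h, norm_zero] at this
      linarith
  · intro X hX σ hσ
    have h1 := hden (X, σ) ⟨hX, hσ⟩
    have h2 := mem_ball_zero_iff.1 (hmul (X, σ) ⟨hX, hσ⟩)
    have hB := norm_monomial_le hq (h2.le.trans hη.le_one) hy (p - 2 * n)
    rw [mem_ball_zero_iff] at hσ
    have h4 : ‖σ‖ ^ (2 * n - 1) ≤ 4 ^ n := by
      calc ‖σ‖ ^ (2 * n - 1) ≤ 2 ^ (2 * n - 1) := by gcongr
        _ ≤ 2 ^ (2 * n) := pow_le_pow_right₀ one_le_two (by omega)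
        _ = 4 ^ n := by rw [pow_mul]; norm_num
    rw [outerField, norm_div, norm_neg, norm_mul, norm_mul, norm_pow, Complex.norm_natCast]
    refine div_le_one_of_le₀ (le_trans ?_ h1) (norm_nonneg _)
    calc _ ≤ p * ‖y‖ * 4 ^ n := by gcongr
      _ ≤ ‖y‖ * (C + p) * 4 ^ n := by
        rw [mul_comm (p : ℝ)]
        gcongr
        linarith
      _ ≤ 1 := hsmall

/-- The form `K X σ dσ` depends on `σ` only through `σ * X`, `σ ^ n` and `dσ / σ`. -/
theorem outerField_symm (hn : 0 < n) {y ζ : ℂ} (hζ : ζ ^ n = 1) (X σ : ℂ) :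
    ζ * outerField p q k n f y X (ζ * σ) = outerField p q k n f y (ζ * X) σ := by
  have h1 : ζ * (ζ * σ) ^ (2 * n - 1) = σ ^ (2 * n - 1) := by
    rw [mul_pow, ← mul_assoc, mul_pow_sub_one (by omega), mul_comm 2 n, pow_mul, hζ, one_pow,
      one_mul]
  have h2 : ζ * σ * X = σ * (ζ * X) := by ring
  have h3 : (ζ * σ) ^ n = σ ^ n := by rw [mul_pow, hζ, one_mul]
  rw [outerField, outerField, outerDen, outerDen, h2, h3, mul_comm 2 n, pow_mul (ζ * σ), h3,
    ← pow_mul, mul_comm n 2, ← h1]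
  ring

theorem outerDen_eq {y x σ t : ℂ} (h : σ ^ n * t = 1) :
    outerDen p q k n f y x σ = σ ^ (2 * n) * dxCoeff p q k n f x y t := by
  rw [outerDen, dxCoeff, mul_comm 2 n, pow_mul]
  linear_combination (-(n : ℂ) * (2 * (σ ^ n * t + 1) + σ ^ n * perturbation p q k n f x y)) * h

/-- Over a path in `t ≠ 0` with `t' = -n * w * t`, that is `σ' = w * σ`, the slope of the leaves
is the logarithmic derivative of `x = σ * X` given by `outerField`. -/
theorem leafSlope_eq {y x X σ t : ℂ} (hn : 0 < n) (h : σ ^ n * t = 1) (hx : x = σ * X)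
    (hD : outerDen p q k n f y x σ ≠ 0) (w : ℂ) :
    leafSlope p q k n f x (y, t) (0, -(n * w) * t) =
      w * (1 + σ * outerField p q k n f y X σ) := by
  have h1 : σ * outerField p q k n f y X σ =
      -(p * (x ^ (p - 2 * n) * y ^ q) * σ ^ (2 * n)) / outerDen p q k n f y x σ := by
    rw [outerField, ← hx, ← mul_pow_sub_one (by omega : 2 * n ≠ 0) σ]
    ring
  have hσ : σ ≠ 0 := by
    rintro rfl
    simp [hn.ne'] at h
  have hD' : dxCoeff p q k n f x y t ≠ 0 := by
    rw [outerDen_eq h] at hD; exact right_ne_zero_of_mul hD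
  rw [h1, outerDen_eq h, leafSlope]
  field_simp
  rw [dxCoeff]
  ring

/-- The holonomy of `α` is periodic: the lifts of `α` lie on the discs `σ ↦ σ * ξ σ b`, which
extend the leaves over `t = ∞`. -/
theorem IsModelBall.hasPeriodicHolonomy_loopAlpha (hη : IsModelBall p q k f η ρ C) (hp : 0 < p)
    (hq : 0 < q) (hk : 0 < k) (hn : 0 < n) (hpn : 2 * n ≤ p) (hkn : n ≤ k * (p / Nat.gcd p q))
    (hε : 0 < ε) (hερ : ε < ρ) (hsmall : ε * (C + p) * 4 ^ n ≤ 1) :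
    HasPeriodicHolonomy η n (loopAlpha ε) n (Complex.exp (2 * Real.pi * Complex.I / (n : ℂ))) := by
  have hnC : (n : ℂ) ≠ 0 := by exact_mod_cast hn.ne'
  have hC := hη.bound_nonneg
  have hyε : ‖(ε : ℂ)‖ = ε := by simp [abs_of_pos hε]
  have hy1 : ‖(ε : ℂ)‖ ≤ 1 := by rw [hyε]; linarith [hη.le_one]
  rw [← hyε] at hsmall
  set w : ℂ := 2 * Real.pi * Complex.I / n with hw
  have hnw : n * w = 2 * Real.pi * Complex.I := by rw [hw]; field_simp
  set ζ : ℂ := Complex.exp w with hζdef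
  have hζ : ζ ^ n = 1 := by
    rw [hζdef, ← Complex.exp_nat_mul, hnw, Complex.exp_two_pi_mul_I]
  have hζ1 : ‖ζ‖ = 1 := Complex.norm_eq_one_of_pow_eq_one hζ hn.ne'
  -- the branch of `t ^ (-1 / n)` along `α` which starts at `1`
  set S : ℝ → ℂ := fun s => Complex.exp (w * s) with hS
  have hSn : ∀ s, S s ^ n * (loopAlpha ε s).2 = 1 := by
    intro s
    rw [hS, loopAlpha]
    simp only
    rw [← Complex.exp_nat_mul, ← Complex.exp_add, ← mul_assoc, hnw, add_neg_cancel,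
      Complex.exp_zero]
  have hS1 : ∀ s, ‖S s‖ = 1 := by
    intro s
    rw [hS]
    simp only
    rw [show w * s = ((2 * Real.pi / n * s : ℝ) : ℂ) * Complex.I by rw [hw]; push_cast; ring,
      Complex.norm_exp_ofReal_mul_I]
  have hSd : ∀ s, HasDerivAt S (w * S s) s := by
    intro s
    have h1 : HasDerivAt (fun s : ℝ => w * (s : ℂ)) w s := by
      simpa using (Complex.ofRealCLM.hasDerivAt (x := s)).const_mul w
    have := h1.cexp
    rwa [mul_comm] at this
  have ht1 : ∀ s, ‖(loopAlpha ε s).2‖ = 1 := by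
    intro s
    have := congrArg norm (hSn s)
    rwa [norm_mul, norm_pow, hS1, one_pow, one_mul, norm_one] at this
  set γ' : ℝ → ℂ × ℂ := fun s => (0, -(n * w) * (loopAlpha ε s).2) with hγ'
  have hγ : ∀ s, HasDerivAt (loopAlpha ε) (γ' s) s := by
    intro s
    refine (hasDerivAt_const s (ε : ℂ)).prodMk ?_
    have h1 : HasDerivAt (fun s : ℝ => -(2 * Real.pi * Complex.I * (s : ℂ)))
        (-(2 * Real.pi * Complex.I)) s := by
      simpa using ((Complex.ofRealCLM.hasDerivAt (x := s)).const_mul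
        (2 * Real.pi * Complex.I : ℂ)).fun_neg
    exact h1.cexp.congr_deriv (by rw [hnw, mul_comm]; rfl)
  have hden : ∀ s, ∀ x ∈ ball (0 : ℂ) ρ, 1 ≤ ‖outerDen p q k n f ε x (S s)‖ := fun s x hx =>
    hη.le_norm_outerDen hp hq hk hn hy1 hsmall (mem_ball_zero_iff.1 hx)
      (by rw [hS1]; norm_num)
  have hden0 : ∀ s, ∀ x ∈ ball (0 : ℂ) ρ, outerDen p q k n f ε x (S s) ≠ 0 := fun s x hx h => by
    have := hden s x hx
    rw [h, norm_zero] at this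
    linarith
  have hdx : ∀ s, ∀ x ∈ ball (0 : ℂ) ρ, 1 ≤ ‖dxCoeff p q k n f x ε (loopAlpha ε s).2‖ := by
    intro s x hx
    have := hden s x hx
    rwa [outerDen_eq (hSn s), norm_mul, norm_pow, hS1, one_pow, one_mul] at this
  have hsolve := hη.liftsSolve hp hq hn hpn hkn (γ := loopAlpha ε) (γ' := γ') (r := ρ)
    (A := 3 * (n * ‖w‖)) (fun s _ => (hγ s).hasDerivWithinAt)
    (fun s _ => hyε.trans_lt hερ) (fun s _ => (ht1 s).le) hη.pos le_rfl (by positivity)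
    (fun s _ x hx h => by
      have := hdx s x hx
      rw [show (ε : ℂ) = (loopAlpha ε s).1 from rfl, h, norm_zero] at this
      linarith)
    (fun s _ x hx => by
      have h1 := hdx s x hx
      have hE := hη.norm_perturbation_le_norm_mul (n := n) hp hq hk (mem_ball_zero_iff.1 hx) hy1
      have hE1 : ‖(ε : ℂ)‖ * C ≤ 1 := by
        refine le_trans ?_ hsmall
        rw [mul_assoc]
        gcongr
        have h4 : (1 : ℝ) ≤ 4 ^ n := one_le_pow₀ (by norm_num)
        have hp0 : (0 : ℝ) ≤ p := Nat.cast_nonneg p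
        nlinarith
      rw [leafSlope, norm_div]
      refine (div_le_self (norm_nonneg _) h1).trans ?_
      simp only [hγ', mul_zero, add_zero]
      rw [norm_neg, norm_mul, norm_mul, ht1, norm_neg, mul_one, norm_mul, Complex.norm_natCast]
      refine mul_le_mul_of_nonneg_right ?_ (by positivity)
      refine (norm_add_le _ _).trans ?_
      rw [norm_mul, ht1, show (loopAlpha ε s).1 = (ε : ℂ) from rfl]
      simp only [Complex.norm_ofNat, mul_one]
      linarith)
  have hK := hη.isBoundedField_outerField hp hq hk hn hy1 hsmall
  obtain ⟨δ, hδ, M, hM, ξ, hξ, hξ0, hξd, hsymm⟩ := hK.exists_solution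
  have hSU : ∀ s, S s ∈ ball (0 : ℂ) 2 := fun s => by
    rw [mem_ball_zero_iff, hS1]; norm_num
  have h1U : (1 : ℂ) ∈ ball (0 : ℂ) 2 := by simp
  have hXd : ∀ b ∈ ball (0 : ℂ) δ, ∀ s : ℝ, HasDerivAt (fun s => S s * (b * ξ (S s) b))
      (S s * (b * ξ (S s) b) *
        leafSlope p q k n f (S s * (b * ξ (S s) b)) (loopAlpha ε s) (γ' s)) s := by
    intro b hb s
    obtain ⟨hne, hmem, hder⟩ := hξd _ (hSU s) b hb
    have hx : S s * (b * ξ (S s) b) ∈ ball (0 : ℂ) ρ := by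
      rw [mem_ball_zero_iff] at hmem ⊢
      rw [norm_mul, hS1, one_mul]
      linarith [hη.pos]
    refine ((hSd s).fun_mul ((hder.comp s (hSd s)).const_mul b)).congr_deriv ?_
    rw [show loopAlpha ε s = ((ε : ℂ), (loopAlpha ε s).2) from rfl,
      leafSlope_eq hn (hSn s) rfl (hden0 s _ hx), Function.comp_apply]
    ring
  have hX : UniformizingFamily
      (fun s x => x * leafSlope p q k n f x (loopAlpha ε s) (γ' s)) δ M
      (fun b s => S s * (b * ξ (S s) b)) (fun b => b * ξ 1 b) ζ := by
    refine ⟨fun b hb s _ => (hXd b hb s).continuousAt.continuousWithinAt, fun b hb hb0 s _ => ?_,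
      fun b hb s _ => ?_, fun b hb s _ => (hXd b hb s).hasDerivWithinAt, fun b hb => ?_,
      fun b hb => ?_⟩
    · exact mul_ne_zero (Complex.exp_ne_zero _) (mul_ne_zero hb0 (hξd _ (hSU s) b hb).1)
    · rw [norm_mul, hS1, one_mul, norm_mul, mul_comm]
      exact mul_le_mul_of_nonneg_right (hξ.norm_le _ (hSU s) b hb) (norm_nonneg _)
    · simp [hS]
    · have h := hsymm ζ hζ1 (fun σ hσ => by
        rw [mem_ball_zero_iff] at hσ ⊢; rwa [norm_mul, hζ1, one_mul])
        (fun X _ σ _ => outerField_symm hn hζ X σ) 1 h1U b hb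
      rw [mul_one] at h
      simp only [hS, Complex.ofReal_one, mul_one]
      rw [← hζdef, h, mul_assoc]
  exact hX.hasPeriodicHolonomy hsolve (half_pos hη.pos) hδ
    (isGermDiffeo_id_mul hδ (hξ.param 1 h1U) (hξd 1 h1U 0 (mem_ball_self hδ)).1) hn.ne' hζ

end Alpha

/-! ### The loop around the origin of the line `t = 0` -/

theorem loopBeta_of_mid (ε : ℝ) {s : ℝ} (h1 : 1 / 3 ≤ s) (h2 : s ≤ 2 / 3) :
    loopBeta ε s =
      ((ε : ℂ) * Complex.exp (-(2 * Real.pi * Complex.I * (3 * (s : ℂ) - 1))), 0) := by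
  rw [loopBeta]
  split_ifs with h
  · obtain rfl : s = 1 / 3 := le_antisymm h h1
    norm_num
  · rfl

theorem loopBeta_of_last (ε : ℝ) {s : ℝ} (h1 : 2 / 3 ≤ s) :
    loopBeta ε s = ((ε : ℂ), 3 * (s : ℂ) - 2) := by
  rcases h1.eq_or_lt with rfl | h
  · rw [loopBeta_of_mid ε (by norm_num) le_rfl]
    norm_num
    rw [Complex.exp_neg, Complex.exp_two_pi_mul_I, inv_one, mul_one]
  · rw [loopBeta, if_neg (by linarith), if_neg (by linarith)]

/-- The velocity, from the right, of the loop `β`. -/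
noncomputable def loopBetaVelocity (ε s : ℝ) : ℂ × ℂ :=
  if s < 1 / 3 then (0, -3)
  else if s < 2 / 3 then (-(2 * Real.pi * Complex.I * 3) * (loopBeta ε s).1, 0)
  else (0, 3)

theorem hasDerivWithinAt_loopBeta (ε s : ℝ) :
    HasDerivWithinAt (loopBeta ε) (loopBetaVelocity ε s) (Ici s) s := by
  have hs : HasDerivAt (fun s : ℝ => (s : ℂ)) 1 s := Complex.ofRealCLM.hasDerivAt
  rw [loopBetaVelocity]
  split_ifs with h1 h2
  · have : HasDerivAt (fun s : ℝ => ((ε : ℂ), 1 - 3 * (s : ℂ))) (0, -3) s := by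
      refine (hasDerivAt_const s (ε : ℂ)).prodMk ?_
      simpa using (hs.const_mul 3).const_sub 1
    refine this.hasDerivWithinAt.congr_of_eventuallyEq ?_ (if_pos h1.le)
    filter_upwards [Ico_mem_nhdsGE h1] with τ hτ using if_pos hτ.2.le
  · rw [not_lt] at h1
    have hval := loopBeta_of_mid ε h1 h2.le
    rw [hval]
    have : HasDerivAt (fun s : ℝ => ((ε : ℂ) *
        Complex.exp (-(2 * Real.pi * Complex.I * (3 * (s : ℂ) - 1))), (0 : ℂ)))
        (-(2 * Real.pi * Complex.I * 3) * ((ε : ℂ) *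
          Complex.exp (-(2 * Real.pi * Complex.I * (3 * (s : ℂ) - 1)))), 0) s := by
      refine HasDerivAt.prodMk ?_ (hasDerivAt_const s (0 : ℂ))
      have h3 := (((hs.const_mul 3).sub_const 1).const_mul (2 * Real.pi * Complex.I)).fun_neg
      exact (h3.cexp.const_mul (ε : ℂ)).congr_deriv (by ring)
    refine this.hasDerivWithinAt.congr_of_eventuallyEq ?_ hval
    filter_upwards [Ico_mem_nhdsGE h2] with τ hτ using
      loopBeta_of_mid ε (h1.trans hτ.1) hτ.2.le
  · rw [not_lt] at h2
    have : HasDerivAt (fun s : ℝ => ((ε : ℂ), 3 * (s : ℂ) - 2)) (0, 3) s := by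
      refine (hasDerivAt_const s (ε : ℂ)).prodMk ?_
      simpa using (hs.const_mul 3).sub_const 2
    refine this.hasDerivWithinAt.congr_of_eventuallyEq ?_ (loopBeta_of_last ε h2)
    filter_upwards [self_mem_nhdsWithin] with τ hτ using loopBeta_of_last ε (h2.trans hτ)

/-- A convex neighbourhood of the segment `[0, 1]` which avoids the zeros of `t ^ 2 + ε ^ q`. -/
def segmentNhd (h : ℝ) : Set ℂ := Ioo (-1) 2 ×ℂ Ioo (-h) h

section Beta

variable {p q k n : ℕ} {f : ℂ → ℂ} {η : OneForm} {ρ C ε r : ℝ}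

theorem ofReal_mem_segmentNhd {h t : ℝ} (hh : 0 < h) (ht : t ∈ Icc (0 : ℝ) 1) :
    (t : ℂ) ∈ segmentNhd h := by
  rw [segmentNhd, Complex.mem_reProdIm]
  simp only [Complex.ofReal_re, Complex.ofReal_im, mem_Ioo]
  exact ⟨⟨by linarith [ht.1], by linarith [ht.2]⟩, by linarith, hh⟩

theorem norm_le_of_mem_segmentNhd {h : ℝ} (hh : h ≤ 1) {t : ℂ} (ht : t ∈ segmentNhd h) :
    ‖t‖ ≤ 3 := by
  rw [segmentNhd, Complex.mem_reProdIm] at ht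
  obtain ⟨⟨h1, h2⟩, h3, h4⟩ := ht
  have h5 : |t.re| ≤ 2 := abs_le.2 ⟨by linarith, h2.le⟩
  have h6 : |t.im| ≤ 1 := abs_le.2 ⟨by linarith, by linarith⟩
  linarith [Complex.norm_le_abs_re_add_abs_im t]

/-- For `n < k * p'` the factor `E` is divisible by `x`. -/
theorem IsModelBall.norm_perturbation_le_mul (hη : IsModelBall p q k f η ρ C) (hp : 0 < p)
    (hq : 0 < q) (hk : 0 < k) (hkn : n < k * (p / Nat.gcd p q)) (hrρ : r ≤ ρ) {x y : ℂ}
    (hx : ‖x‖ < r) (hy : ‖y‖ ≤ 1) : ‖perturbation p q k n f x y‖ ≤ r * C := by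
  have hC := hη.bound_nonneg
  have hxρ : ‖x‖ < ρ := hx.trans_le hrρ
  refine (hη.norm_perturbation_le hp hq hk hxρ hy).trans ?_
  calc _ ≤ ‖x‖ * (1 * C) := by
        gcongr
        exact pow_le_of_le_one (norm_nonneg _) (hxρ.le.trans hη.le_one) (by omega)
    _ ≤ r * C := by rw [one_mul]; gcongr

/-- When `p = 2 * n` and `E` vanishes on `x = 0`, the coefficient of `dx` is close to
`p * (t ^ 2 + ε ^ q)`, which has no zero near the real segment. -/
theorem IsModelBall.le_norm_dxCoeff (hη : IsModelBall p q k f η ρ C) (hp : 0 < p)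
    (hq : 0 < q) (hk : 0 < k) (hpn : p = 2 * n) (hkn : n < k * (p / Nat.gcd p q))
    (hε : 0 < ε) (hε1 : ε ≤ 1) (hrρ : r ≤ ρ) (hr : r * C * 6 ≤ ε ^ q) {x t : ℂ}
    (hx : ‖x‖ < r) (ht : t ∈ segmentNhd (ε ^ q / 2)) :
    ε ^ q ≤ ‖dxCoeff p q k n f x ε t‖ := by
  have hεq : 0 < ε ^ q := pow_pos hε q
  have hεq1 : ε ^ q ≤ 1 := pow_le_one₀ hε.le hε1
  have hy1 : ‖(ε : ℂ)‖ ≤ 1 := by simpa [abs_of_pos hε] using hε1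
  have hE := hη.norm_perturbation_le_mul hp hq hk hkn hrρ hx hy1
  have ht3 := norm_le_of_mem_segmentNhd (by linarith) ht
  set E := perturbation p q k n f x ε with hEdef
  have h1 : dxCoeff p q k n f x ε t = n * (2 * (t ^ 2 + (ε : ℂ) ^ q) - -(t * E)) := by
    rw [dxCoeff, ← hEdef, hpn, Nat.sub_self]
    push_cast
    ring
  have h2 : 2 * (ε ^ q * (3 / 4)) ≤ ‖2 * (t ^ 2 + (ε : ℂ) ^ q)‖ := by
    rw [norm_mul, Complex.norm_ofNat]
    gcongr
    refine le_trans ?_ (Complex.re_le_norm _)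
    rw [segmentNhd, Complex.mem_reProdIm] at ht
    obtain ⟨-, h3, h4⟩ := ht
    have h5 : (t ^ 2 + (ε : ℂ) ^ q).re = t.re * t.re - t.im * t.im + ε ^ q := by
      rw [← Complex.ofReal_pow, Complex.add_re, Complex.ofReal_re, pow_two, Complex.mul_re]
    rw [h5]
    have h6 : t.im * t.im ≤ ε ^ q / 2 * (ε ^ q / 2) := by nlinarith
    nlinarith [mul_self_nonneg t.re]
  have h3 : ‖-(t * E)‖ ≤ 3 * (r * C) := by
    rw [norm_neg, norm_mul]
    gcongr
  have h4 := norm_sub_norm_le (2 * (t ^ 2 + (ε : ℂ) ^ q)) (-(t * E))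
  have hn1 : (1 : ℝ) ≤ n := by exact_mod_cast (by omega : 1 ≤ n)
  rw [h1, norm_mul, Complex.norm_natCast]
  have h5 : ε ^ q ≤ ‖2 * (t ^ 2 + (ε : ℂ) ^ q) - -(t * E)‖ := by linarith
  exact h5.trans (le_mul_of_one_le_left (norm_nonneg _) hn1)

theorem leafSlope_vertical (x y t c : ℂ) :
    leafSlope p q k n f x (y, t) (0, c) = c * leafSlope p q k n f x (y, t) (0, 1) := by
  simp only [leafSlope]
  ring

theorem IsModelBall.norm_leafSlope_le (hη : IsModelBall p q k f η ρ C) (hp : 0 < p)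
    (hq : 0 < q) (hk : 0 < k) (hpn : p = 2 * n) (hkn : n < k * (p / Nat.gcd p q))
    (hε : 0 < ε) (hε1 : ε ≤ 1) (hrρ : r ≤ ρ) (hr : r * C * 6 ≤ ε ^ q) {x t : ℂ}
    (hx : ‖x‖ < r) (ht : t ∈ segmentNhd (ε ^ q / 2)) :
    ‖leafSlope p q k n f x (ε, t) (0, 1)‖ ≤ 7 / ε ^ q := by
  have hεq : 0 < ε ^ q := pow_pos hε q
  have hεq1 : ε ^ q ≤ 1 := pow_le_one₀ hε.le hε1
  have hy1 : ‖(ε : ℂ)‖ ≤ 1 := by simpa [abs_of_pos hε] using hε1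
  have hE := hη.norm_perturbation_le_mul hp hq hk hkn hrρ hx hy1
  have ht3 := norm_le_of_mem_segmentNhd (by linarith) ht
  have hD := hη.le_norm_dxCoeff hp hq hk hpn hkn hε hε1 hrρ hr hx ht
  rw [leafSlope, norm_div]
  gcongr
  simp only [mul_one, mul_zero, add_zero, norm_neg]
  refine (norm_add_le _ _).trans ?_
  rw [norm_mul, Complex.norm_ofNat]
  linarith

theorem IsModelBall.isBoundedField_leafSlope (hη : IsModelBall p q k f η ρ C) (hp : 0 < p)
    (hq : 0 < q) (hk : 0 < k) (hpn : p = 2 * n) (hkn : n < k * (p / Nat.gcd p q))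
    (hε : 0 < ε) (hε1 : ε ≤ 1) (hr0 : 0 < r) (hrρ : r ≤ ρ) (hr : r * C * 6 ≤ ε ^ q) :
    IsBoundedField (segmentNhd (ε ^ q / 2)) 3 r (7 / ε ^ q)
      (fun X t => leafSlope p q k n f X (ε, t) (0, 1)) := by
  have hεq : 0 < ε ^ q := pow_pos hε q
  have hεq1 : ε ^ q ≤ 1 := pow_le_one₀ hε.le hε1
  have hy1 : ‖(ε : ℂ)‖ ≤ 1 := by simpa [abs_of_pos hε] using hε1
  refine ⟨isOpen_Ioo.reProdIm isOpen_Ioo, ((convex_Ioo _ _).is_linear_preimage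
    Complex.reLm.isLinear).inter ((convex_Ioo _ _).is_linear_preimage Complex.imLm.isLinear), ?_,
    fun t ht => norm_le_of_mem_segmentNhd (by linarith) ht, hr0, by positivity, ?_,
    fun X hX t ht => hη.norm_leafSlope_le hp hq hk hpn hkn hε hε1 hrρ hr
      (mem_ball_zero_iff.1 hX) ht⟩
  · simpa using ofReal_mem_segmentNhd (half_pos hεq) (left_mem_Icc.2 zero_le_one)
  · have hE : DifferentiableOn ℂ (fun P : ℂ × ℂ => perturbation p q k n f P.1 ε)
        (ball 0 r ×ˢ segmentNhd (ε ^ q / 2)) :=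
      (hη.differentiableOn_perturbation hp hq hy1).comp (f := fun P : ℂ × ℂ => P.1)
        (by fun_prop) fun P hP => ball_subset_ball hrρ hP.1
    unfold leafSlope
    simp only [div_eq_mul_inv]
    refine DifferentiableOn.fun_mul ?_ (DifferentiableOn.fun_inv ?_ fun P hP h => ?_)
    · exact ((((show DifferentiableOn ℂ (fun P : ℂ × ℂ => 2 * P.2) _ by fun_prop).add
        hE).mul_const _).add (by fun_prop)).neg
    · unfold dxCoeff
      exact (((show DifferentiableOn ℂ (fun P : ℂ × ℂ => P.2) _ by fun_prop).mul
        ((show DifferentiableOn ℂ (fun P : ℂ × ℂ => 2 * P.2) _ by fun_prop).add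
        hE)).const_mul _).add (by fun_prop)
    · have := hη.le_norm_dxCoeff hp hq hk hpn hkn hε hε1 hrρ hr (mem_ball_zero_iff.1 hP.1) hP.2
      rw [h, norm_zero] at this
      linarith

/-- Along `t = 0` the foliation is `d (x ^ p * y ^ q) = 0`. -/
theorem leafSlope_horizontal (hpn : p = 2 * n) (hp : 0 < p) (hq : 0 < q) {x y : ℂ} (hy : y ≠ 0)
    (c : ℂ) : leafSlope p q k n f x (y, 0) (-c * y, 0) = c * (q / p) := by
  have hpC : (p : ℂ) ≠ 0 := by exact_mod_cast hp.ne'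
  have hyq : y ^ q ≠ 0 := pow_ne_zero _ hy
  have h1 : y ^ (q - 1) * y = y ^ q := pow_sub_one_mul hq.ne' y
  simp only [leafSlope, dxCoeff]
  rw [hpn, Nat.sub_self, ← hpn, pow_zero]
  field_simp
  linear_combination (c * q * p) * h1

/-- Every point of `β` is either on one of the vertical segments or on the circle `t = 0`. -/
theorem loopBeta_cases (hε : 0 < ε) {s : ℝ} (hs : s ∈ Ico (0 : ℝ) 1) :
    (∃ t ∈ Icc (0 : ℝ) 1, ∃ c : ℂ, ‖c‖ = 3 ∧ loopBeta ε s = ((ε : ℂ), (t : ℂ)) ∧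
      loopBetaVelocity ε s = (0, c)) ∨
    ∃ y : ℂ, ‖y‖ = ε ∧ loopBeta ε s = (y, 0) ∧
      loopBetaVelocity ε s = (-(2 * Real.pi * Complex.I * 3) * y, 0) := by
  rcases lt_or_ge s (1 / 3) with h1 | h1
  · refine Or.inl ⟨1 - 3 * s, ⟨by linarith, by linarith [hs.1]⟩, -3, by simp, ?_, if_pos h1⟩
    rw [loopBeta, if_pos h1.le]
    push_cast
    rfl
  rcases lt_or_ge s (2 / 3) with h2 | h2
  · have h := loopBeta_of_mid ε h1 h2.le
    refine Or.inr ⟨(loopBeta ε s).1, ?_, ?_, ?_⟩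
    · rw [h, norm_mul, show -(2 * Real.pi * Complex.I * (3 * (s : ℂ) - 1)) =
        ((-(2 * Real.pi * (3 * s - 1)) : ℝ) : ℂ) * Complex.I by push_cast; ring,
        Complex.norm_exp_ofReal_mul_I, mul_one, Complex.norm_real, Real.norm_eq_abs, abs_of_pos hε]
    · rw [h]
    · rw [loopBetaVelocity, if_neg h1.not_gt, if_pos h2]
  · refine Or.inl ⟨3 * s - 2, ⟨by linarith, by linarith [hs.2]⟩, 3, by simp, ?_, ?_⟩
    · rw [loopBeta_of_last ε h2]
      push_cast
      rfl
    · rw [loopBetaVelocity, if_neg h1.not_gt, if_neg h2.not_gt]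

theorem IsModelBall.liftsSolve_loopBeta (hη : IsModelBall p q k f η ρ C) (hp : 0 < p)
    (hq : 0 < q) (hk : 0 < k) (hpn : p = 2 * n) (hkn : n < k * (p / Nat.gcd p q))
    (hε : 0 < ε) (hερ : ε < ρ) (hr0 : 0 < r) (hrρ : r ≤ ρ) (hr : r * C * 6 ≤ ε ^ q) :
    LiftsSolve η n (loopBeta ε) (r / 2)
      (fun s x => x * leafSlope p q k n f x (loopBeta ε s) (loopBetaVelocity ε s)) := by
  have hεq : 0 < ε ^ q := pow_pos hε q
  have hε1 : ε ≤ 1 := hερ.le.trans hη.le_one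
  have hpC : (p : ℂ) ≠ 0 := by exact_mod_cast hp.ne'
  refine hη.liftsSolve hp hq (by omega) hpn.ge hkn.le
    (A := 3 * (7 / ε ^ q) + ‖2 * Real.pi * Complex.I * 3 * ((q : ℂ) / p)‖)
    (fun s _ => hasDerivWithinAt_loopBeta ε s) (fun s hs => ?_) (fun s hs => ?_) hr0 hrρ
    (by positivity) (fun s hs x hx => ?_) (fun s hs x hx => ?_)
  all_goals
    rcases loopBeta_cases hε hs with ⟨t, ht, c, hc, h1, h2⟩ | ⟨y, hy, h1, h2⟩ <;> rw [h1]
  · simpa [abs_of_pos hε] using hερ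
  · simpa [hy] using hερ
  · simpa [abs_of_nonneg ht.1] using ht.2
  · simp
  · intro h
    have := hη.le_norm_dxCoeff hp hq hk hpn hkn hε hε1 hrρ hr (mem_ball_zero_iff.1 hx)
      (ofReal_mem_segmentNhd (half_pos hεq) ht)
    rw [h, norm_zero] at this
    linarith
  · have hy0 : y ≠ 0 := norm_pos_iff.1 (hy ▸ hε)
    rw [dxCoeff, ← hpn, Nat.sub_self]
    simpa using ⟨hp.ne', fun h => absurd h hy0⟩
  · rw [h2, leafSlope_vertical, norm_mul, hc]
    have := hη.norm_leafSlope_le hp hq hk hpn hkn hε hε1 hrρ hr (mem_ball_zero_iff.1 hx)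
      (ofReal_mem_segmentNhd (half_pos hεq) ht)
    have h3 := norm_nonneg (2 * Real.pi * Complex.I * 3 * ((q : ℂ) / p))
    linarith
  · have hy0 : y ≠ 0 := norm_pos_iff.1 (hy ▸ hε)
    rw [h2, leafSlope_horizontal hpn hp hq hy0]
    have : 0 ≤ 7 / ε ^ q := by positivity
    linarith

/-- The lift of `β` built from a solution `ξ` along the segment: since `ξ 0 = 1`, only one of the
three factors varies on each of the three pieces. -/
noncomputable def betaLift (ξ : ℂ → ℂ → ℂ) (μ b : ℂ) (s : ℝ) : ℂ :=
  b * ξ ((max 0 (1 - 3 * s) : ℝ) : ℂ) b * Complex.exp (μ * ((max 0 (min 1 (3 * s - 1)) : ℝ) : ℂ)) *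
    ξ ((max 0 (3 * s - 2) : ℝ) : ℂ) (Complex.exp μ * b)

theorem betaLift_of_first {ξ : ℂ → ℂ → ℂ} (hξ : ∀ a, ξ 0 a = 1) (μ b : ℂ) {s : ℝ}
    (h : s ≤ 1 / 3) : betaLift ξ μ b s = b * ξ (1 - 3 * (s : ℂ)) b := by
  have h1 : max 0 (1 - 3 * s) = 1 - 3 * s := max_eq_right (by linarith)
  have h2 : max 0 (min 1 (3 * s - 1)) = 0 := max_eq_left ((min_le_right _ _).trans (by linarith))
  have h3 : max 0 (3 * s - 2) = 0 := max_eq_left (by linarith)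
  rw [betaLift, h1, h2, h3]
  simp [hξ]

theorem betaLift_of_mid {ξ : ℂ → ℂ → ℂ} (hξ : ∀ a, ξ 0 a = 1) (μ b : ℂ) {s : ℝ}
    (h : 1 / 3 ≤ s) (h' : s ≤ 2 / 3) :
    betaLift ξ μ b s = b * Complex.exp (μ * (3 * (s : ℂ) - 1)) := by
  have h1 : max 0 (1 - 3 * s) = 0 := max_eq_left (by linarith)
  have h2 : max 0 (min 1 (3 * s - 1)) = 3 * s - 1 := by
    rw [min_eq_right (by linarith), max_eq_right (by linarith)]
  have h3 : max 0 (3 * s - 2) = 0 := max_eq_left (by linarith)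
  rw [betaLift, h1, h2, h3]
  simp [hξ]

theorem betaLift_of_last {ξ : ℂ → ℂ → ℂ} (hξ : ∀ a, ξ 0 a = 1) (μ b : ℂ) {s : ℝ}
    (h : 2 / 3 ≤ s) :
    betaLift ξ μ b s = Complex.exp μ * b * ξ (3 * (s : ℂ) - 2) (Complex.exp μ * b) := by
  have h1 : max 0 (1 - 3 * s) = 0 := max_eq_left (by linarith)
  have h2 : max 0 (min 1 (3 * s - 1)) = 1 := by
    rw [min_eq_left (by linarith), max_eq_right zero_le_one]
  have h3 : max 0 (3 * s - 2) = 3 * s - 2 := max_eq_right (by linarith)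
  rw [betaLift, h1, h2, h3]
  simp [hξ, mul_comm b]

/-- The holonomy of `β` is periodic: it is the rotation along `t = 0` conjugated by the holonomy
of the segment. -/
theorem IsModelBall.hasPeriodicHolonomy_loopBeta (hη : IsModelBall p q k f η ρ C) (hp : 0 < p)
    (hq : 0 < q) (hk : 0 < k) (hpn : p = 2 * n) (hkn : n < k * (p / Nat.gcd p q))
    (hε : 0 < ε) (hερ : ε < ρ) :
    HasPeriodicHolonomy η n (loopBeta ε) (p / Nat.gcd p q)
      (Complex.exp (2 * Real.pi * Complex.I *
        (((q / Nat.gcd p q : ℕ) : ℂ) / ((p / Nat.gcd p q : ℕ) : ℂ)))) := by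
  have hC := hη.bound_nonneg
  have hρ := hη.pos
  have hεq : 0 < ε ^ q := pow_pos hε q
  have hε1 : ε ≤ 1 := hερ.le.trans hη.le_one
  obtain ⟨hP, -⟩ := gcd_quotients_pos hp hq
  have hPC : ((p / Nat.gcd p q : ℕ) : ℂ) ≠ 0 := by exact_mod_cast hP.ne'
  have hpC : (p : ℂ) ≠ 0 := by exact_mod_cast hp.ne'
  have hratio : ((q / Nat.gcd p q : ℕ) : ℂ) / ((p / Nat.gcd p q : ℕ) : ℂ) = (q : ℂ) / p := by
    have h1 : ((Nat.gcd p q : ℕ) : ℂ) * (p / Nat.gcd p q : ℕ) = p := by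
      exact_mod_cast Nat.mul_div_cancel' (Nat.gcd_dvd_left p q)
    have h2 : ((Nat.gcd p q : ℕ) : ℂ) * (q / Nat.gcd p q : ℕ) = q := by
      exact_mod_cast Nat.mul_div_cancel' (Nat.gcd_dvd_right p q)
    rw [div_eq_div_iff hPC hpC, ← h1, ← h2]
    ring
  set μ : ℂ := 2 * Real.pi * Complex.I *
    (((q / Nat.gcd p q : ℕ) : ℂ) / ((p / Nat.gcd p q : ℕ) : ℂ)) with hμ
  have hcP : Complex.exp μ ^ (p / Nat.gcd p q) = 1 := by
    rw [← Complex.exp_nat_mul, Complex.exp_eq_one_iff]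
    refine ⟨((q / Nat.gcd p q : ℕ) : ℤ), ?_⟩
    rw [hμ, Int.cast_natCast]
    field_simp
  have hexp : ∀ s : ℝ, ‖Complex.exp (μ * s)‖ = 1 := fun s => by
    rw [show μ * s = ((2 * Real.pi * ((q / Nat.gcd p q : ℕ) / (p / Nat.gcd p q : ℕ)) * s : ℝ) : ℂ)
      * Complex.I by rw [hμ]; push_cast; ring, Complex.norm_exp_ofReal_mul_I]
  have hc1 : ‖Complex.exp μ‖ = 1 := by simpa using hexp 1
  obtain ⟨r, hr0, hrρ, hr⟩ : ∃ r > 0, r ≤ ρ ∧ r * C * 6 ≤ ε ^ q := by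
    -- `C + 1` instead of `C`, which may vanish
    refine ⟨min ρ (ε ^ q / (6 * (C + 1))), by positivity, min_le_left _ _, ?_⟩
    calc _ ≤ ε ^ q / (6 * (C + 1)) * (C + 1) * 6 := by
          gcongr
          · exact min_le_right _ _
          · linarith
      _ = ε ^ q := by field_simp
  have hsolve := hη.liftsSolve_loopBeta hp hq hk hpn hkn hε hερ hr0 hrρ hr
  have hK := hη.isBoundedField_leafSlope hp hq hk hpn hkn hε hε1 hr0 hrρ hr
  obtain ⟨δ, hδ, M, hM, ξ, hξ, hξ0, hξd, -⟩ := hK.exists_solution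
  have hmem : ∀ t ∈ Icc (0 : ℝ) 1, (t : ℂ) ∈ segmentNhd (ε ^ q / 2) := fun t ht =>
    ofReal_mem_segmentNhd (half_pos hεq) ht
  have h1U : (1 : ℂ) ∈ segmentNhd (ε ^ q / 2) := by
    simpa using hmem 1 (right_mem_Icc.2 zero_le_one)
  have hcb : ∀ b ∈ ball (0 : ℂ) δ, Complex.exp μ * b ∈ ball (0 : ℂ) δ := fun b hb => by
    rw [mem_ball_zero_iff] at hb ⊢; rwa [norm_mul, hc1, one_mul]
  have ht₁ : ∀ s ∈ Icc (0 : ℝ) 1, max 0 (1 - 3 * s) ∈ Icc (0 : ℝ) 1 := fun s hs =>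
    ⟨le_max_left _ _, max_le zero_le_one (by linarith [hs.1])⟩
  have ht₂ : ∀ s ∈ Icc (0 : ℝ) 1, max 0 (3 * s - 2) ∈ Icc (0 : ℝ) 1 := fun s hs =>
    ⟨le_max_left _ _, max_le zero_le_one (by linarith [hs.2])⟩
  -- the solution `ξ`, followed along a real path in the `t`-line
  have hvert : ∀ a ∈ ball (0 : ℂ) δ, ∀ (T : ℝ → ℂ) (c : ℂ) (s : ℝ), T s ∈ segmentNhd (ε ^ q / 2) →
      HasDerivAt T c s → HasDerivAt (fun s => a * ξ (T s) a)
        (a * ξ (T s) a * leafSlope p q k n f (a * ξ (T s) a) (ε, T s) (0, c)) s := by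
    intro a ha T c s hT hTd
    refine ((((hξd _ hT a ha).2.2).comp s hTd).const_mul a).congr_deriv ?_
    rw [leafSlope_vertical _ _ _ c]
    ring
  have hX : UniformizingFamily
      (fun s x => x * leafSlope p q k n f x (loopBeta ε s) (loopBetaVelocity ε s)) δ (M * M)
      (betaLift ξ μ) (fun b => b * ξ 1 b) (Complex.exp μ) := by
    refine ⟨fun b hb => ?_, fun b hb hb0 s hs => ?_, fun b hb s hs => ?_, fun b hb s hs => ?_,
      fun b hb => ?_, fun b hb => ?_⟩
    · refine ((continuousOn_const.mul ?_).mul (by fun_prop)).mul ?_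
      · exact (hξ.time b hb).continuousOn.comp (f := fun s : ℝ => ((max 0 (1 - 3 * s) : ℝ) : ℂ))
          (by fun_prop) fun s hs => hmem _ (ht₁ s hs)
      · exact (hξ.time _ (hcb b hb)).continuousOn.comp
          (f := fun s : ℝ => ((max 0 (3 * s - 2) : ℝ) : ℂ))
          (by fun_prop) fun s hs => hmem _ (ht₂ s hs)
    · exact mul_ne_zero (mul_ne_zero (mul_ne_zero hb0 (hξd _ (hmem _ (ht₁ s hs)) b hb).1)
        (Complex.exp_ne_zero _)) (hξd _ (hmem _ (ht₂ s hs)) _ (hcb b hb)).1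
    · rw [betaLift, norm_mul, norm_mul, norm_mul, hexp, mul_one]
      calc _ ≤ ‖b‖ * M * M := by
            gcongr
            · exact hξ.norm_le _ (hmem _ (ht₁ s hs)) b hb
            · exact hξ.norm_le _ (hmem _ (ht₂ s hs)) _ (hcb b hb)
        _ = M * M * ‖b‖ := by ring
    · have hsd : HasDerivAt (fun s : ℝ => (s : ℂ)) 1 s := Complex.ofRealCLM.hasDerivAt
      rcases lt_or_ge s (1 / 3) with h1 | h1
      · have h := hvert b hb (fun s => 1 - 3 * (s : ℂ)) (-3) s
          (by simpa using hmem (1 - 3 * s) ⟨by linarith, by linarith [hs.1]⟩)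
          (by simpa using (hsd.const_mul 3).const_sub 1)
        rw [← betaLift_of_first hξ0 μ b h1.le] at h
        rw [loopBeta, if_pos h1.le, loopBetaVelocity, if_pos h1]
        refine h.hasDerivWithinAt.congr_of_eventuallyEq ?_ (betaLift_of_first hξ0 μ b h1.le)
        filter_upwards [Ico_mem_nhdsGE h1] with τ hτ using betaLift_of_first hξ0 μ b hτ.2.le
      rcases lt_or_ge s (2 / 3) with h2 | h2
      · have hval := betaLift_of_mid hξ0 μ b h1 h2.le
        have hy0 : (loopBeta ε s).1 ≠ 0 := by
          rw [loopBeta_of_mid ε h1 h2.le]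
          exact mul_ne_zero (by exact_mod_cast hε.ne') (Complex.exp_ne_zero _)
        have hpt : loopBeta ε s = ((loopBeta ε s).1, 0) := by
          rw [loopBeta_of_mid ε h1 h2.le]
        rw [loopBetaVelocity, if_neg h1.not_gt, if_pos h2, hpt,
          leafSlope_horizontal hpn hp hq hy0, ← hratio, hval]
        have h : HasDerivAt (fun s : ℝ => b * Complex.exp (μ * (3 * (s : ℂ) - 1)))
            (b * Complex.exp (μ * (3 * (s : ℂ) - 1)) * (2 * Real.pi * Complex.I * 3 *
              (((q / Nat.gcd p q : ℕ) : ℂ) / ((p / Nat.gcd p q : ℕ) : ℂ)))) s := by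
          refine ((((hsd.const_mul 3).sub_const 1).const_mul μ).cexp.const_mul b).congr_deriv ?_
          rw [hμ]
          ring
        refine h.hasDerivWithinAt.congr_of_eventuallyEq ?_ hval
        filter_upwards [Ico_mem_nhdsGE h2] with τ hτ using
          betaLift_of_mid hξ0 μ b (h1.trans hτ.1) hτ.2.le
      · have h := hvert _ (hcb b hb) (fun s => 3 * (s : ℂ) - 2) 3 s
          (by simpa using hmem (3 * s - 2) ⟨by linarith, by linarith [hs.2]⟩)
          (by simpa using (hsd.const_mul 3).sub_const 2)
        rw [← betaLift_of_last hξ0 μ b h2] at h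
        rw [loopBeta_of_last ε h2, loopBetaVelocity, if_neg h1.not_gt, if_neg h2.not_gt]
        refine h.hasDerivWithinAt.congr_of_eventuallyEq ?_ (betaLift_of_last hξ0 μ b h2)
        filter_upwards [self_mem_nhdsWithin] with τ hτ using
          betaLift_of_last hξ0 μ b (h2.trans hτ)
    · rw [betaLift_of_first hξ0 μ b (by norm_num)]
      simp
    · rw [betaLift_of_last hξ0 μ b (by norm_num)]
      norm_num
  exact hX.hasPeriodicHolonomy hsolve (half_pos hr0) hδ
    (isGermDiffeo_id_mul hδ (hξ.param 1 h1U) (hξd 1 h1U 0 (mem_ball_self hδ)).1) hP.ne' hcP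

end Beta

end QuasiOrdinaryCusp

/-! ### Periodicity of the holonomies -/

open QuasiOrdinaryCusp in
theorem mainTheorem3 (p q k : ℕ) (hp : 0 < p) (hq : 0 < q) (hk : 0 < k) (hpeven : Even p)
    (f : ℂ → ℂ) (hf : AnalyticAt ℂ f 0) (hf0 : f 0 ≠ 0)
    (ω : OneForm) (Φ : C3 → C3) (hω : IsModelChart p q k f ω Φ) :
    (Nat.gcd p q ≤ 2 * k →
      ∀ᶠ ε in 𝓝[>] (0 : ℝ),
        HasPeriodicHolonomy (pullback Φ ω) (p / 2) (loopAlpha ε) (p / 2)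
            (Complex.exp (-(2 * Real.pi * Complex.I * (((p : ℂ) - 2) / p)))) ∧
          (Odd q →
            HasPeriodicHolonomy (pullback Φ ω) (p / 2) (loopBeta ε) (p / Nat.gcd p q)
              (Complex.exp (2 * Real.pi * Complex.I *
                (((q / Nat.gcd p q : ℕ) : ℂ) / ((p / Nat.gcd p q : ℕ) : ℂ)))))) ∧
    (2 * k < Nat.gcd p q →
      ∀ᶠ ε in 𝓝[>] (0 : ℝ),
        HasPeriodicHolonomy (pullback Φ ω) (k * (p / Nat.gcd p q)) (loopAlpha ε)
          (k * (p / Nat.gcd p q))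
          (Complex.exp (2 * Real.pi * Complex.I / ((k * (p / Nat.gcd p q) : ℕ) : ℂ)))) := by
  obtain ⟨ρ, C, hη⟩ := hω.exists_isModelBall hf
  obtain ⟨hP, -⟩ := gcd_quotients_pos hp hq
  have hpd : Nat.gcd p q * (p / Nat.gcd p q) = p := Nat.mul_div_cancel' (Nat.gcd_dvd_left p q)
  have hsmall : ∀ n : ℕ, ∀ᶠ ε in 𝓝[>] (0 : ℝ), 0 < ε ∧ ε < ρ ∧ ε * (C + p) * 4 ^ n ≤ 1 := by
    intro n
    have h1 : Tendsto (fun ε : ℝ => ε * (C + p) * 4 ^ n) (𝓝 0) (𝓝 0) := by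
      have : Continuous fun ε : ℝ => ε * (C + p) * 4 ^ n := by fun_prop
      simpa using this.tendsto 0
    filter_upwards [self_mem_nhdsWithin, (gt_mem_nhds hη.pos).filter_mono nhdsWithin_le_nhds,
      (h1.eventually (gt_mem_nhds one_pos)).filter_mono nhdsWithin_le_nhds] with ε h2 h3 h4
    exact ⟨h2, h3, h4.le⟩
  refine ⟨fun hdk => ?_, fun hdk => ?_⟩
  · obtain ⟨n, hn⟩ := hpeven
    obtain rfl : p = 2 * n := by omega
    rw [Nat.mul_div_cancel_left n two_pos]
    have hkn : n ≤ k * (2 * n / Nat.gcd (2 * n) q) := by nlinarith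
    have hnC : (n : ℂ) ≠ 0 := by exact_mod_cast (by omega : n ≠ 0)
    filter_upwards [hsmall n] with ε ⟨hε, hερ, hεs⟩
    refine ⟨?_, fun hqodd => ?_⟩
    · -- the exponents differ by `2 * π * I`, since `(p - 2) / p = 1 - 1 / n`
      have hmult : Complex.exp (-(2 * Real.pi * Complex.I * ((((2 * n : ℕ) : ℂ) - 2) /
          (2 * n : ℕ)))) = Complex.exp (2 * Real.pi * Complex.I / (n : ℂ)) := by
        refine (Complex.exp_periodic _).symm.trans ?_
        congr 1
        push_cast
        field_simp
        ring
      rw [hmult]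
      exact hη.hasPeriodicHolonomy_loopAlpha hp hq hk (by omega) le_rfl hkn hε hερ hεs
    · -- `gcd p q` is odd, so the inequality `gcd p q ≤ 2 * k` is strict
      have hodd : Odd (Nat.gcd (2 * n) q) := hqodd.of_dvd_nat (Nat.gcd_dvd_right _ _)
      have hlt : Nat.gcd (2 * n) q < 2 * k := by
        obtain ⟨m, hm⟩ := hodd
        omega
      have hkn' : n < k * (2 * n / Nat.gcd (2 * n) q) := by nlinarith
      exact hη.hasPeriodicHolonomy_loopBeta hp hq hk rfl hkn' hε hερ
  · filter_upwards [hsmall (k * (p / Nat.gcd p q))] with ε ⟨hε, hερ, hεs⟩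
    exact hη.hasPeriodicHolonomy_loopAlpha hp hq hk (Nat.mul_pos hk hP) (by nlinarith) le_rfl
      hε hερ hεs
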